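/- Let $K$ be a field and $\Lambda=\Lambda(x_i\mid i\ge 0)$ the Grassmann algebra over $K$ in the odd letters $x_i$, with the $\mathbb Z_2$-grading it induces on $\operatorname{End}\Lambda$. Let $\partial_i$ be the superderivations of $\Lambda$ with $\partial_i(x_j)=\delta_{ij}$, identify $x_i$ with left multiplication by $x_i$, and put $$v_i=\partial_i+x_ix_{i+1}\bigl(\partial_{i+2}+x_{i+2}x_{i+3}(\partial_{i+4}+x_{i+4}x_{i+5}(\partial_{i+6}+\cdots))\bigr)\in\operatorname{End}\Lambda ,\qquad i\ge 0 .$$ Let $\mathbf R$ be the algebra of one of the types below generated by $v_0,v_1$ inside $\operatorname{End}\Lambda$, where * for the Lie superalgebra the product is the supercommutator, and if $\operatorname{char}K=2$ one also has the squares $a\mapsto a^2$ of odd elements; * for the Lie algebra ($\operatorname{char}K=2$) the only operation is the commutator; * for the restricted Lie superalgebra, respectively the restricted Lie algebra ($\operatorname{char}K=2$), one has the supercommutator and the squares of even and of odd elements, respectively the commutator and the squares of all elements. Let $\mathbf R_n$ be the span of the monomials (iterated products and squares, as far as they belong to the type) of total degree $n$ in $v_0,v_1$. Let $\mathbf R^1=\mathbf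 R$ and, for $n\ge2$, let $\mathbf R^n$ be the span of $[\mathbf R,\mathbf R^{n-1}]$ together with the squares of those elements of $\mathbf R^{\lceil n/2\rceil}$ that may be squared in the given type. Say that $\mathbf R$ has width $d$ if $d$ is the least integer with $\dim\mathbf R_n\le d$ for all $n\ge1$. Then, in each of the cases below, $\mathbf R=\bigoplus_{n\ge1}\mathbf R_n$ is a grading compatible with the operations, $a_n:=\dim\mathbf R_n=\dim \mathbf R^n/\mathbf R^{n+1}$ for all $n\ge1$, and: 1. if $\operatorname{char}K\ne2$ and $\mathbf R$ is the Lie superalgebra, then $a_n\in\{2,3,4\}$ for all $n\ge1$, and $\mathbf R$ has width $4$; 2. if $\operatorname{char}K=2$ and $\mathbf R$ is the Lie algebra, then $a_n\in\{1,2\}$ for all $n\ge1$, and $\mathbf R$ has width $2$; 3. if $\operatorname{char}K=2$ and $\mathbf R$ is the Lie superalgebra, the restricted Lie superalgebra or the restricted Lie algebra, then $a_n\in\{1,2,3\}$ for all $n\ge1$, and $\mathbf R$ has width $3$. -/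

import Mathlib

namespace PivotLie

/-- The Grassmann algebra `Λ(x_i | i ≥ 0)` over `K` in countably many variables. -/
abbrev Grassmann (K : Type*) [Field K] : Type _ := ExteriorAlgebra K (ℕ →₀ K)

/-- All linear endomorphisms of the Grassmann algebra. -/
abbrev EndG (K : Type*) [Field K] : Type _ := Module.End K (Grassmann K)

section Pivot

variable (K : Type*) [Field K]

/-- The Grassmann variable `x_i`. -/
noncomputable def x (i : ℕ) : Grassmann K := ExteriorAlgebra.ι K (Finsupp.single i 1)

/-- The superderivative `∂_i`, of odd degree: `∂_i (x_j) = δ_ij` and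
`∂_i (x_j f) = δ_ij f - x_j ∂_i f`. In Mathlib it is the left contraction with the `i`-th
coordinate functional. -/
noncomputable def d (i : ℕ) : EndG K := CliffordAlgebra.contractLeft (Finsupp.lapply i)

/-- Every element of the Grassmann algebra is killed by almost all `∂_i`. -/
theorem exists_d_eq_zero (f : Grassmann K) : ∃ N, ∀ i, N ≤ i → d K i f = 0 := by
  induction f using CliffordAlgebra.left_induction with
  | algebraMap r =>
    exact ⟨0, fun i _ => CliffordAlgebra.contractLeft_algebraMap _ _ r⟩
  | add a b ha hb =>
    obtain ⟨N, hN⟩ := ha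
    obtain ⟨M, hM⟩ := hb
    refine ⟨max N M, fun i hi => ?_⟩
    rw [map_add, hN i (le_trans (le_max_left _ _) hi), hM i (le_trans (le_max_right _ _) hi),
      add_zero]
  | ι_mul a m ha =>
    obtain ⟨N, hN⟩ := ha
    refine ⟨max N (m.support.sup id + 1), fun i hi => ?_⟩
    have h1 : d K i a = 0 := hN i (le_trans (le_max_left _ _) hi)
    have h2 : m i = 0 := by
      by_contra h
      have h3 : i ≤ m.support.sup id :=
        Finset.le_sup (f := id) (Finsupp.mem_support_iff.mpr h)
      have h4 := le_trans (le_max_right _ _) hi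
      omega
    unfold d at h1 ⊢
    rw [CliffordAlgebra.contractLeft_ι_mul, h1, mul_zero, sub_zero]
    simp [h2]

/-- The `l`-th term `x_i x_{i+1} ⋯ x_{i+2l-1} ∂_{i+2l}` of the series of `v_i`. -/
noncomputable def pivotTerm (i l : ℕ) : EndG K :=
  LinearMap.mulLeft K (((List.range (2 * l)).map fun j => x K (i + j)).prod) * d K (i + 2 * l)

theorem pivotTerm_finite (i : ℕ) (f : Grassmann K) :
    (Function.support fun l => pivotTerm K i l f).Finite := by
  obtain ⟨N, hN⟩ := exists_d_eq_zero K f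
  refine (Set.finite_lt_nat N).subset fun l hl => ?_
  by_contra h
  simp only [Set.mem_ofPred_eq, not_lt] at h
  apply hl
  simp [pivotTerm, hN (i + 2 * l) (by omega)]

/-- The pivot element
`v_i = ∂_i + x_i x_{i+1} (∂_{i+2} + x_{i+2} x_{i+3} (∂_{i+4} + ⋯))`. The infinite sum acts on
each element of the Grassmann algebra through finitely many nonzero terms. -/
noncomputable def v (i : ℕ) : EndG K where
  toFun f := ∑ᶠ l : ℕ, pivotTerm K i l f
  map_add' f g := by
    simp only [map_add]
    exact finsum_add_distrib (pivotTerm_finite K i f) (pivotTerm_finite K i g)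
  map_smul' c f := by
    simp only [map_smul, RingHom.id_apply]
    exact (smul_finsum' c (pivotTerm_finite K i f)).symm

end Pivot

section Super

variable {K : Type*} [Field K]

/-- The component `Λ_α` of the `ℤ/2`-grading of the Grassmann algebra, all `x_i` being odd. -/
noncomputable abbrev parityPart (K : Type*) [Field K] (α : ZMod 2) : Submodule K (Grassmann K) :=
  CliffordAlgebra.evenOdd (0 : QuadraticForm K (ℕ →₀ K)) α

/-- `φ` is homogeneous of parity `α`: `φ (Λ_β) ⊆ Λ_{α+β}`. -/
def IsHomog (α : ZMod 2) (φ : EndG K) : Prop :=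
  ∀ β : ZMod 2, ∀ f ∈ parityPart K β, φ f ∈ parityPart K (α + β)

/-- The component of parity `α` of an endomorphism. -/
noncomputable def homogPart (α : ZMod 2) (φ : EndG K) : EndG K :=
  ∑ β : ZMod 2,
    GradedAlgebra.proj (parityPart K) (α + β) * φ * GradedAlgebra.proj (parityPart K) β

/-- The supercommutator: `[a, b] = a b - (-1)^{αβ} b a` for `a`, `b` homogeneous of parities
`α`, `β`, extended bilinearly. -/
noncomputable def superBracket (a b : EndG K) : EndG K :=
  ∑ α : ZMod 2, ∑ β : ZMod 2,
    (homogPart α a * homogPart β b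
      - (-1 : K) ^ (α.val * β.val) • (homogPart β b * homogPart α a))

end Super

/-- The operations with respect to which a subalgebra of `End Λ` is generated: a bracket, and
squaring `a ↦ a²` for the elements `a` of the set `sq`. -/
structure Ops (K : Type*) [Field K] where
  br : EndG K → EndG K → EndG K
  sq : Set (EndG K)

section Kinds

variable (K : Type*) [Field K]

/-- Lie superalgebras: the supercommutator and, in characteristic 2 only, squares of odd
elements. -/
noncomputable def lieSuper : Ops K where
  br := superBracket
  sq := {a | ringChar K = 2 ∧ IsHomog 1 a}

/-- Lie algebras: the commutator only. -/
noncomputable def lie : Ops K where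
  br a b := a * b - b * a
  sq := ∅

/-- Restricted Lie superalgebras in characteristic 2: the supercommutator, squares of odd
elements (the quadratic mapping) and of even elements (the `p`-mapping). -/
noncomputable def restrictedLieSuper2 : Ops K where
  br := superBracket
  sq := {a | IsHomog 1 a ∨ IsHomog 0 a}

/-- Restricted Lie algebras in characteristic 2: the commutator and squares of all elements. -/
noncomputable def restrictedLie2 : Ops K where
  br a b := a * b - b * a
  sq := Set.univ

end Kinds

section Algebra

variable {K : Type*} [Field K] (Φ : Ops K)

/-- The algebra `R` of the given kind generated by `v_0, v_1`: the least subspace containing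
them and closed under the operations. -/
noncomputable def R : Submodule K (EndG K) :=
  sInf {S | v K 0 ∈ S ∧ v K 1 ∈ S ∧ (∀ a ∈ S, ∀ b ∈ S, Φ.br a b ∈ S) ∧
    ∀ a ∈ S, a ∈ Φ.sq → a * a ∈ S}

/-- Monomials in `v_0, v_1` with respect to the operations, with their multidegree. -/
inductive IsMonomial : ℕ → ℕ → EndG K → Prop
  | v_zero : IsMonomial 1 0 (v K 0)
  | v_one : IsMonomial 0 1 (v K 1)
  | br {n₁ n₂ m₁ m₂ : ℕ} {a b : EndG K} :
      IsMonomial n₁ n₂ a → IsMonomial m₁ m₂ b → IsMonomial (n₁ + m₁) (n₂ + m₂) (Φ.br a b)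
  | sq {n₁ n₂ : ℕ} {a : EndG K} :
      IsMonomial n₁ n₂ a → a ∈ Φ.sq → IsMonomial (2 * n₁) (2 * n₂) (a * a)

/-- The multidegree component `R_{n₁,n₂}`. -/
noncomputable def multiComp (n₁ n₂ : ℕ) : Submodule K (EndG K) :=
  Submodule.span K {a | IsMonomial Φ n₁ n₂ a}

/-- The component `R_n` of degree `n`, the sum of the `R_{n₁,n₂}` with `n₁ + n₂ = n`. -/
noncomputable def degComp (n : ℕ) : Submodule K (EndG K) :=
  ⨆ n₁ : ℕ, ⨆ n₂ : ℕ, ⨆ _ : n₁ + n₂ = n, multiComp Φ n₁ n₂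

/-- The lower central series: `R^1 = R`, and `R^n` is the span of `[R, R^{n-1}]` and of the
squares of those elements of `R^{⌈n/2⌉}` that have a square. The value at `0` is unused. -/
noncomputable def lcs : ℕ → Submodule K (EndG K)
  | 0 => R Φ
  | 1 => R Φ
  | n + 2 =>
    Submodule.span K {c | ∃ a ∈ R Φ, ∃ b ∈ lcs (n + 1), c = Φ.br a b} ⊔
    Submodule.span K {c | ∃ a ∈ lcs ((n + 3) / 2), a ∈ Φ.sq ∧ c = a * a}
  termination_by n => n
  decreasing_by all_goals omega

/-- The dimension of `R_n`. -/
noncomputable def degDim (n : ℕ) : ℕ := Module.finrank K (degComp Φ n)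

/-- The dimension of the quotient `M / N` for subspaces `N ⊆ M`. -/
noncomputable def quotDim {V : Type*} [AddCommGroup V] [Module K V] (M N : Submodule K V) : ℕ :=
  Module.finrank K (M ⧸ N.submoduleOf M)

/-- The dimension of the lower central series factor `R^n / R^{n+1}`. -/
noncomputable def lcsFactorDim (n : ℕ) : ℕ :=
  quotDim (lcs Φ n) (lcs Φ (n + 1))

/-- `R = ⨁_{n ≥ 1} R_n` is a grading compatible with the operations. -/
def IsDegreeGrading : Prop :=
  degComp Φ 0 = ⊥ ∧ iSupIndep (degComp Φ) ∧ ⨆ n, degComp Φ n = R Φ ∧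
  (∀ m n, ∀ a ∈ degComp Φ m, ∀ b ∈ degComp Φ n, Φ.br a b ∈ degComp Φ (m + n)) ∧
  ∀ n, ∀ a ∈ degComp Φ n, a ∈ Φ.sq → a * a ∈ degComp Φ (2 * n)

/-- `R` has width `w`: `w` is the least integer with `dim R_n ≤ w` for all `n ≥ 1`. -/
def HasWidth (w : ℕ) : Prop :=
  IsLeast {k : ℕ | ∀ n, 1 ≤ n → Module.rank K (degComp Φ n) ≤ (k : Cardinal)} w

end Algebra

end PivotLie

/-! The algebras have explicit bases of monomials `x_S v_n`, where `x_S` is the ordered product of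
the letters with index in a set `S` of indices below `n`. Everything follows from `v_n = ∂_n + x_n
x_{n+1} v_{n+2}` and the anticommutation of `v_n` with letters and derivations of smaller index.
First, `v_n² = x_{n+1} v_{n+2}` and `[v_n, v_{n+1}] = -x_n v_{n+2}`. For `n ≤ m`, the
supercommutator of `x_S v_n` with `x_T v_m` is then zero, a monomial or twice a monomial, up to sign
(`mBr_cases`). If `T` has a letter of index at least `n`, the smallest one `x_{n+2l}` is replaced by
`x_n ⋯ x_{n+2l-1}`, and an odd offset gives zero. If not, the result depends on the parity of `m -
n`. The factor 2 occurs only for even `m - n`, and this is how the characteristic enters.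

Give `v_n` degree `dg n` and `x_n` degree `-dg n`; brackets then add degrees. Each type has its own
index set, closed under the operations (`brClosed_indLie`, `brClosed_indChar2`, `brClosed_indSuper`,
and `Model.sq_mem` for squares). Conversely, a monomial of the set with `n ≥ 2` is a multiple of the
bracket of `v_0` or `v_1` with a monomial of degree one less (`genBr_indLie`, `genBr_indSuper`), or
in characteristic 2 the square of some `v_m`. The monomials are independent (`linearIndepOn_mXv`).
Hence those of degree `n` form a basis of `R_n`, and those of degree at least `n` a basis of `R^n`,
which gives the grading and the equality of dimensions.

What remains is to count subsets of given weight. The weights of `0, …, m-1` add up to `dg m` or `dg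
m - 1`, so every possible sum is attained once or twice (`cnt_bounds`), and only a few levels `n`
contribute to a given degree. The bounds 4, 2 and 3 are attained in degrees 5, 1 and 2. -/

namespace PivotLie

/-! ### Equality up to sign -/

section SignEq

/-- Equality up to sign. -/
def SignEq {A : Type*} [Neg A] (a b : A) : Prop := a = b ∨ a = -b

variable {A : Type*} [Ring A] {a b c : A}

theorem SignEq.rfl : SignEq a a := Or.inl (Eq.refl _)

theorem SignEq.trans (h : SignEq a b) (h' : SignEq b c) : SignEq a c := by
  rcases h with rfl | rfl
  · exact h'
  · rcases h' with rfl | rfl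
    exacts [.inr (Eq.refl _), .inl (neg_neg _)]

theorem SignEq.mul_left (h : SignEq a b) (c : A) : SignEq (c * a) (c * b) := by
  rcases h with rfl | rfl
  exacts [.rfl, .inr (mul_neg _ _)]

theorem SignEq.mul_right (h : SignEq a b) (c : A) : SignEq (a * c) (b * c) := by
  rcases h with rfl | rfl
  exacts [.rfl, .inr (neg_mul _ _)]

theorem SignEq.neg_left (h : SignEq a b) : SignEq (-a) b := by
  rcases h with rfl | rfl
  exacts [.inr (Eq.refl _), .inl (neg_neg _)]

theorem SignEq.eq_zero (h : SignEq a b) (hb : b = 0) : a = 0 := by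
  subst hb
  rcases h with rfl | rfl <;> simp

theorem SignEq.smul {K : Type*} [Field K] [Algebra K A] (h : SignEq a b) (n : ℕ) :
    SignEq ((-1 : K) ^ n • a) b := by
  rcases neg_one_pow_eq_or K n with hn | hn <;> rw [hn]
  · rwa [one_smul]
  · rw [neg_one_smul]
    exact h.neg_left

theorem SignEq.exists_smul (K : Type*) [Field K] [Algebra K A] (h : SignEq a b) :
    ∃ c : K, c ≠ 0 ∧ a = c • b := by
  rcases h with rfl | rfl
  · exact ⟨1, one_ne_zero, (one_smul _ _).symm⟩
  · exact ⟨-1, neg_ne_zero.2 one_ne_zero, (neg_one_smul _ _).symm⟩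

end SignEq

/-! ### Relations of letters, derivations and pivots; products of letters -/

section System

/-- The relations between left multiplications by Grassmann variables, superderivatives and pivot
elements. -/
structure PivotSystem {A : Type*} [Ring A] (mx d v : ℕ → A) : Prop where
  mx_mul_self (i : ℕ) : mx i * mx i = 0
  mx_mul_comm (i j : ℕ) : mx i * mx j = -(mx j * mx i)
  d_mul_self (i : ℕ) : d i * d i = 0
  d_mul_mx_self (i : ℕ) : d i * mx i = 1 - mx i * d i
  d_mul_mx {i j : ℕ} (h : i ≠ j) : d i * mx j = -(mx j * d i)
  v_eq (i : ℕ) : v i = d i + mx i * mx (i + 1) * v (i + 2)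
  mx_mul_v {i m : ℕ} (h : i < m) : mx i * v m = -(v m * mx i)
  d_mul_v {i m : ℕ} (h : i < m) : d i * v m = -(v m * d i)

variable (K : Type*) [Field K] {A : Type*} [Ring A] [Algebra K A] {mx d v : ℕ → A}

/-- The ordered product `x_{i₁} ⋯ x_{iₖ}` for `S = {i₁ < ⋯ < iₖ}`. -/
def mX (mx : ℕ → A) (S : Finset ℕ) : A := (S.sort.map mx).prod

theorem mX_empty : mX mx ∅ = 1 := by simp [mX]

theorem mX_insert_min {a : ℕ} {S : Finset ℕ} (h : ∀ b ∈ S, a < b) :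
    mX mx (insert a S) = mx a * mX mx S := by
  rw [mX, Finset.sort_insert (· ≤ ·) (fun b hb => (h b hb).le) (fun ha => lt_irrefl _ (h a ha))]
  simp [mX]

theorem mX_singleton (a : ℕ) : mX mx {a} = mx a := by
  have := mX_insert_min (mx := mx) (a := a) (S := ∅) (by simp)
  simpa [mX_empty] using this

/-- An element anticommuting with all `x_i`, `i ∈ S`, moves past the monomial `x_S`. -/
theorem mul_mX_of_anticomm {a : A} {S : Finset ℕ} (h : ∀ i ∈ S, a * mx i = -(mx i * a)) :
    a * mX mx S = (-1 : K) ^ S.card • (mX mx S * a) := by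
  induction S using Finset.induction_on_min with
  | empty => simp [mX_empty]
  | insert b S hb ih =>
    have hbS : b ∉ S := fun hbS => lt_irrefl _ (hb b hbS)
    rw [mX_insert_min hb, Finset.card_insert_of_notMem hbS, ← mul_assoc,
      h b (Finset.mem_insert_self _ _), neg_mul, mul_assoc,
      ih fun i hi => h i (Finset.mem_insert_of_mem hi), pow_succ]
    simp [mul_assoc]

namespace PivotSystem

variable (P : PivotSystem mx d v)

include P

theorem mx_mul_mX_of_mem {a : ℕ} {S : Finset ℕ} (h : a ∈ S) : mx a * mX mx S = 0 := by
  induction S using Finset.induction_on_min with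
  | empty => simp at h
  | insert b S hb ih =>
    rw [mX_insert_min hb, ← mul_assoc]
    rcases Finset.mem_insert.1 h with rfl | h
    · rw [P.mx_mul_self, zero_mul]
    · rw [P.mx_mul_comm, neg_mul, mul_assoc, ih h]
      simp

theorem mx_mul_mX {a : ℕ} {S : Finset ℕ} (h : a ∉ S) :
    SignEq (mx a * mX mx S) (mX mx (insert a S)) := by
  induction S using Finset.induction_on_min with
  | empty => exact .inl (by simp [mX_empty, mX_singleton])
  | insert b S hb ih =>
    have hab : a ≠ b := fun e => h (by simp [e])
    have haS : a ∉ S := fun e => h (by simp [e])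
    rcases lt_or_gt_of_ne hab with hlt | hlt
    · rw [← mX_insert_min (a := a)]
      · exact .rfl
      · intro c hc
        rcases Finset.mem_insert.1 hc with rfl | hc
        exacts [hlt, hlt.trans (hb c hc)]
    · rw [mX_insert_min hb, Finset.insert_comm, mX_insert_min (a := b), ← mul_assoc,
        P.mx_mul_comm, neg_mul, mul_assoc]
      · exact ((ih haS).mul_left _).neg_left
      · intro c hc
        rcases Finset.mem_insert.1 hc with rfl | hc
        exacts [hlt, hb c hc]

theorem mX_mul_mX {S T : Finset ℕ} (h : Disjoint S T) :
    SignEq (mX mx S * mX mx T) (mX mx (S ∪ T)) := by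
  induction S using Finset.induction_on_min with
  | empty => exact .inl (by simp [mX_empty])
  | insert b S hb ih =>
    rw [Finset.disjoint_insert_left] at h
    rw [mX_insert_min hb, Finset.insert_union, mul_assoc]
    refine ((ih h.2).mul_left _).trans (P.mx_mul_mX ?_)
    rw [Finset.mem_union, not_or]
    exact ⟨fun hbS => lt_irrefl _ (hb b hbS), h.1⟩

theorem mX_mul_mX_of_not_disjoint {S T : Finset ℕ} (h : ¬ Disjoint S T) :
    mX mx S * mX mx T = 0 := by
  induction S using Finset.induction_on_min with
  | empty => simp at h
  | insert b S hb ih =>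
    rw [mX_insert_min hb, mul_assoc]
    by_cases hS : Disjoint S T
    · rw [Finset.disjoint_insert_left, not_and_or, not_not] at h
      have hbT : b ∈ T := h.resolve_right (not_not.2 hS)
      refine ((P.mX_mul_mX hS).mul_left _).eq_zero (P.mx_mul_mX_of_mem ?_)
      exact Finset.mem_union_right _ hbT
    · rw [ih hS, mul_zero]

theorem v_mul_mX {m : ℕ} {S : Finset ℕ} (h : ∀ i ∈ S, i < m) :
    v m * mX mx S = (-1 : K) ^ S.card • (mX mx S * v m) :=
  mul_mX_of_anticomm K fun i hi => by rw [P.mx_mul_v (h i hi), neg_neg]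

theorem mx_mul_mX_comm (i : ℕ) (S : Finset ℕ) :
    mx i * mX mx S = (-1 : K) ^ S.card • (mX mx S * mx i) :=
  mul_mX_of_anticomm K fun j _ => P.mx_mul_comm i j

theorem mX_mul_mX_comm (S T : Finset ℕ) :
    mX mx S * mX mx T = (-1 : K) ^ (S.card * T.card) • (mX mx T * mX mx S) := by
  induction S using Finset.induction_on_min with
  | empty => simp [mX_empty]
  | insert b S hb ih =>
    have hbS : b ∉ S := fun hbS => lt_irrefl _ (hb b hbS)
    rw [mX_insert_min hb, Finset.card_insert_of_notMem hbS, mul_assoc, ih, mul_smul_comm,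
      ← mul_assoc, P.mx_mul_mX_comm K, smul_mul_assoc, smul_smul, mul_assoc, add_mul, one_mul,
      pow_add]

theorem d_mul_mX {i : ℕ} {S : Finset ℕ} (h : i ∉ S) :
    d i * mX mx S = (-1 : K) ^ S.card • (mX mx S * d i) :=
  mul_mX_of_anticomm K fun j hj => P.d_mul_mx (by rintro rfl; exact h hj)

end PivotSystem
end System
-- Supercommutators of a pivot with a monomial
section Bracket

variable (K : Type*) [Field K] {A : Type*} [Ring A] [Algebra K A] {mx d v : ℕ → A}

theorem mX_union_of_lt {P Q : Finset ℕ} (h : ∀ p ∈ P, ∀ q ∈ Q, p < q) :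
    mX mx (P ∪ Q) = mX mx P * mX mx Q := by
  induction P using Finset.induction_on_min with
  | empty => simp [mX_empty]
  | insert b S hb ih =>
    rw [Finset.insert_union, mX_insert_min, mX_insert_min hb, mul_assoc,
      ih fun p hp => h p (Finset.mem_insert_of_mem hp)]
    intro c hc
    rcases Finset.mem_union.1 hc with hc | hc
    exacts [hb c hc, h b (Finset.mem_insert_self _ _) c hc]

theorem mX_Ico_add_two (n l : ℕ) :
    mX mx (Finset.Ico n (n + 2 * (l + 1))) =
      mx n * mx (n + 1) * mX mx (Finset.Ico (n + 2) (n + 2 + 2 * l)) := by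
  have h : Finset.Ico n (n + 2 * (l + 1)) =
      insert n (insert (n + 1) (Finset.Ico (n + 2) (n + 2 + 2 * l))) := by
    ext i
    simp only [Finset.mem_insert, Finset.mem_Ico]
    omega
  rw [h, mX_insert_min, mX_insert_min, mul_assoc] <;> intro b hb <;>
    simp only [Finset.mem_insert, Finset.mem_Ico] at hb <;> omega

theorem mX_Ico_add_two' (n l : ℕ) :
    mX mx (Finset.Ico n (n + 2 * (l + 1) + 1)) =
      mx n * mx (n + 1) * mX mx (Finset.Ico (n + 2) (n + 2 + 2 * l + 1)) := by
  have h : Finset.Ico n (n + 2 * (l + 1) + 1) =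
      insert n (insert (n + 1) (Finset.Ico (n + 2) (n + 2 + 2 * l + 1))) := by
    ext i
    simp only [Finset.mem_insert, Finset.mem_Ico]
    omega
  rw [h, mX_insert_min, mX_insert_min, mul_assoc] <;> intro b hb <;>
    simp only [Finset.mem_insert, Finset.mem_Ico] at hb <;> omega

/-- The product `x_S v_n`. -/
def mXv (mx v : ℕ → A) (i : Finset ℕ × ℕ) : A := mX mx i.1 * v i.2

/-- The supercommutator `[v_n, x_T v_m]`. -/
def vBr (mx v : ℕ → A) (n : ℕ) (T : Finset ℕ) (m : ℕ) : A :=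
  v n * (mX mx T * v m) + (-1 : K) ^ T.card • (mX mx T * v m * v n)

/-- The supercommutator `[x_S v_n, x_T v_m]`. -/
def mBr (mx v : ℕ → A) (i j : Finset ℕ × ℕ) : A :=
  mXv mx v i * mXv mx v j -
    (-1 : K) ^ ((i.1.card + 1) * (j.1.card + 1)) • (mXv mx v j * mXv mx v i)

theorem neg_one_pow_smul_smul (n : ℕ) (a : A) : (-1 : K) ^ n • (-1 : K) ^ n • a = a := by
  rw [smul_smul, ← pow_add, ← two_mul, pow_mul]
  simp

namespace PivotSystem

variable (P : PivotSystem mx d v)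

include P

theorem mx_mul_mX_mul_v {i m : ℕ} (h : i < m) (S : Finset ℕ) :
    mx i * (mX mx S * v m) = -((-1 : K) ^ S.card • (mX mx S * v m * mx i)) := by
  rw [← mul_assoc, P.mx_mul_mX_comm K, smul_mul_assoc, mul_assoc, P.mx_mul_v h, mul_neg, smul_neg,
    mul_assoc]

theorem mX_mul_v_mul_mx {i m : ℕ} (h : i < m) (S : Finset ℕ) :
    mX mx S * v m * mx i = -((-1 : K) ^ S.card • (mx i * (mX mx S * v m))) := by
  rw [P.mx_mul_mX_mul_v K h, smul_neg, neg_neg, neg_one_pow_smul_smul]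

theorem d_mul_mX_mul_v {i m : ℕ} (h : i < m) {S : Finset ℕ} (hS : i ∉ S) :
    d i * (mX mx S * v m) = -((-1 : K) ^ S.card • (mX mx S * v m * d i)) := by
  rw [← mul_assoc, P.d_mul_mX K hS, smul_mul_assoc, mul_assoc, P.d_mul_v h, mul_neg, smul_neg,
    mul_assoc]

theorem mx_mul_v_mul_mx {i m : ℕ} (h : i < m) : mx i * v m * mx i = 0 := by
  rw [mul_assoc, ← neg_neg (v m * mx i), ← P.mx_mul_v h, mul_neg, ← mul_assoc, P.mx_mul_self]
  simp

/-- In the expansion of `v_n` into derivation and tail, both squares vanish. In the mixed products,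
moving `∂_n` past `x_n` leaves `x_{n+1} v_{n+2}`, and the rest cancels. -/
theorem v_mul_v_self (n : ℕ) : v n * v n = mx (n + 1) * v (n + 2) := by
  have h1 := P.d_mul_mx (i := n) (j := n + 1) (by omega)
  have h2 := P.d_mul_v (i := n) (m := n + 2) (by omega)
  have h3 := P.mx_mul_v (i := n) (m := n + 2) (by omega)
  have h4 : mx n * mx (n + 1) * v (n + 2) * mx n = 0 := by
    rw [mul_assoc, show v (n + 2) * mx n = -(mx n * v (n + 2)) by rw [h3, neg_neg], mul_neg,
      ← mul_assoc, P.mx_mul_comm n, neg_mul, mul_assoc (mx (n + 1)), P.mx_mul_self]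
    simp
  have h5 : d n * (mx n * mx (n + 1) * v (n + 2)) =
      mx (n + 1) * v (n + 2) - mx n * mx (n + 1) * v (n + 2) * d n := by
    rw [← mul_assoc, ← mul_assoc, P.d_mul_mx_self, sub_mul, sub_mul, one_mul, mul_assoc (mx n), h1,
      mul_neg, neg_mul, mul_assoc, mul_assoc, h2]
    simp [mul_assoc]
  have h6 : mx n * mx (n + 1) * v (n + 2) * (mx n * mx (n + 1) * v (n + 2)) = 0 := by
    rw [← mul_assoc, ← mul_assoc, h4]
    simp
  rw [P.v_eq n, add_mul, mul_add, mul_add, P.d_mul_self, h5, h6]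
  abel

/-- The derivation in `v_n` anticommutes with `v_{n+1}`. In the tail `x_n x_{n+1} v_{n+2}`, the
pivot `v_{n+1}` removes the letter `x_{n+1}`, and the sign comes from passing `x_n`. -/
theorem v_mul_v_succ (n : ℕ) : v n * v (n + 1) + v (n + 1) * v n = -(mx n * v (n + 2)) := by
  have h1 : v (n + 1) * mx (n + 1) * v (n + 2) = v (n + 2) + mx (n + 1) * v (n + 2) * d (n + 1) := by
    rw [P.v_eq (n + 1), add_mul, P.d_mul_mx_self,
      show mx (n + 1) * mx (n + 1 + 1) * v (n + 1 + 2) * mx (n + 1) = 0 by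
        rw [mul_assoc, ← neg_neg (v _ * mx _), ← P.mx_mul_v (by omega), P.mx_mul_comm, neg_mul_neg,
          mul_assoc, ← mul_assoc (mx (n + 1)), P.mx_mul_self]
        simp, add_zero, sub_mul, one_mul, mul_assoc, P.d_mul_v (by omega)]
    simp [mul_assoc]
  have h2 : mx (n + 1) * v (n + 2) * v (n + 1) = mx (n + 1) * v (n + 2) * d (n + 1) := by
    rw [P.v_eq (n + 1), mul_add, ← mul_assoc, ← mul_assoc (_ * v (n + 2)),
      P.mx_mul_v_mul_mx (by omega)]
    simp
  have h3 := P.d_mul_v (i := n) (m := n + 1) (by omega)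
  have h4 : v (n + 1) * (mx n * mx (n + 1) * v (n + 2)) =
      -(mx n * (v (n + 1) * mx (n + 1) * v (n + 2))) := by
    rw [← mul_assoc, ← mul_assoc, ← neg_neg (v (n + 1) * mx n), ← P.mx_mul_v (by omega)]
    simp [mul_assoc]
  rw [P.v_eq n, add_mul, mul_add, h4, h1, h3, mul_assoc (mx n), mul_assoc (mx n), h2]
  noncomm_ring

/-- No index below `n + 2` occurs in the monomial, so `∂_n` contributes nothing and the even factor
`x_n x_{n+1}` of the tail comes out. This is the recursion behind all inductions on the offset. -/
theorem vBr_step {n m : ℕ} {Q : Finset ℕ} (hm : n + 2 ≤ m) (hQ : ∀ i ∈ Q, n + 2 ≤ i) :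
    vBr K mx v n Q m = mx n * mx (n + 1) * vBr K mx v (n + 2) Q m := by
  have h1 := P.d_mul_mX_mul_v K (i := n) (m := m) (by omega) (S := Q)
    (fun h => by have := hQ n h; omega)
  have h2 : mX mx Q * v m * (mx n * mx (n + 1) * v (n + 2)) =
      mx n * mx (n + 1) * (mX mx Q * v m * v (n + 2)) := by
    rw [← mul_assoc, ← mul_assoc, P.mX_mul_v_mul_mx K (by omega), neg_mul, smul_mul_assoc,
      mul_assoc (mx n), P.mX_mul_v_mul_mx K (by omega), mul_neg, smul_neg, neg_neg, mul_smul_comm,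
      neg_one_pow_smul_smul]
    simp only [mul_assoc]
  rw [vBr, vBr, P.v_eq n, add_mul, mul_add, h1, h2, mul_add, smul_add, mul_smul_comm]
  simp only [mul_assoc]
  abel

/-- Only `∂_n` contributes, by removing `x_n`; the products with the tail contain `x_n` twice. -/
theorem vBr_insert_self {n m : ℕ} {Q : Finset ℕ} (hm : n < m) (hQ : ∀ i ∈ Q, n < i) :
    vBr K mx v n (insert n Q) m = mX mx Q * v m := by
  have hn : n ∉ Q := fun h => lt_irrefl _ (hQ n h)
  have h1 := P.d_mul_mX_mul_v K (i := n) hm hn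
  have h2 : mx n * (mX mx Q * v m) * (mx n * mx (n + 1) * v (n + 2)) = 0 := by
    rw [← mul_assoc, ← mul_assoc, mul_assoc (mx n), P.mX_mul_v_mul_mx K hm, mul_neg,
      mul_smul_comm, ← mul_assoc, P.mx_mul_self]
    simp
  have h3 : mx n * mx (n + 1) * v (n + 2) * (mx n * (mX mx Q * v m)) = 0 := by
    rw [← mul_assoc, P.mx_mul_comm, neg_mul, neg_mul, mul_assoc (mx (n + 1)),
      mul_assoc (mx (n + 1)), P.mx_mul_v_mul_mx (by omega)]
    simp
  rw [vBr, mX_insert_min hQ, Finset.card_insert_of_notMem hn, mul_assoc (mx n), P.v_eq n, add_mul,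
    mul_add, h2, h3, ← mul_assoc, P.d_mul_mx_self, sub_mul, one_mul, mul_assoc, h1, pow_succ]
  simp [mul_assoc]

/-- The derivation `∂_n` does not meet the letter `x_{n+1}`, and the products with the tail contain
that letter twice. -/
theorem vBr_insert_succ {n m : ℕ} {Q : Finset ℕ} (hm : n + 1 < m) (hQ : ∀ i ∈ Q, n + 1 < i) :
    vBr K mx v n (insert (n + 1) Q) m = 0 := by
  have hn : n ∉ insert (n + 1) Q := fun h => by
    rcases Finset.mem_insert.1 h with h | h
    · omega
    · have := hQ n h; omega
  have h1 := P.d_mul_mX_mul_v K (i := n) (m := m) (by omega) hn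
  have h2 : mX mx (insert (n + 1) Q) * v m * (mx n * mx (n + 1) * v (n + 2)) = 0 := by
    rw [P.mx_mul_comm, ← mul_assoc, mul_neg, ← mul_assoc, P.mX_mul_v_mul_mx K (by omega),
      ← mul_assoc, P.mx_mul_mX_of_mem (Finset.mem_insert_self _ _)]
    simp
  have h3 : mx n * mx (n + 1) * v (n + 2) * (mX mx (insert (n + 1) Q) * v m) = 0 := by
    rw [mX_insert_min hQ, mul_assoc (mx (n + 1)), ← mul_assoc, mul_assoc (mx n),
      mul_assoc (mx n), P.mx_mul_v_mul_mx (by omega)]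
    simp
  rw [vBr, P.v_eq n, add_mul, mul_add, h2, h3, h1]
  simp

theorem vBr_even {n m : ℕ} (l : ℕ) {Q : Finset ℕ} (hm : n + 2 * l < m)
    (hQ : ∀ i ∈ Q, n + 2 * l < i) :
    vBr K mx v n (insert (n + 2 * l) Q) m = mX mx (Finset.Ico n (n + 2 * l)) * (mX mx Q * v m) := by
  induction l generalizing n with
  | zero => simpa [mX_empty] using P.vBr_insert_self K hm hQ
  | succ l ih =>
    rw [P.vBr_step K (by omega), mX_Ico_add_two, show n + 2 * (l + 1) = n + 2 + 2 * l by ring,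
      ih (by omega), mul_assoc (mx n * _)]
    · intro i hi
      have := hQ i hi
      omega
    · intro i hi
      rcases Finset.mem_insert.1 hi with hi | hi
      · omega
      · have := hQ i hi; omega

theorem vBr_odd {n m : ℕ} (l : ℕ) {Q : Finset ℕ} (hm : n + 2 * l + 1 < m)
    (hQ : ∀ i ∈ Q, n + 2 * l + 1 < i) : vBr K mx v n (insert (n + 2 * l + 1) Q) m = 0 := by
  induction l generalizing n with
  | zero => exact P.vBr_insert_succ K hm hQ
  | succ l ih =>
    rw [P.vBr_step K (by omega), show n + 2 * (l + 1) + 1 = n + 2 + 2 * l + 1 by ring,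
      ih (by omega), mul_zero]
    · intro i hi
      have := hQ i hi
      omega
    · intro i hi
      rcases Finset.mem_insert.1 hi with hi | hi
      · omega
      · have := hQ i hi; omega

/-- The recursion ends at the supercommutator of an odd element with itself, which is twice its
square; this is the only source of the factor 2. -/
theorem vBr_empty_even (n l : ℕ) :
    vBr K mx v n ∅ (n + 2 * l) =
      (2 : K) • (mX mx (Finset.Ico n (n + 2 * l)) * (mx (n + 2 * l + 1) * v (n + 2 * l + 2))) := by
  induction l generalizing n with
  | zero => simp [vBr, mX_empty, P.v_mul_v_self, two_smul]
  | succ l ih =>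
    rw [P.vBr_step K (by omega) (by simp), mX_Ico_add_two,
      show n + 2 * (l + 1) = n + 2 + 2 * l by ring, ih, mul_smul_comm, mul_assoc (mx n * _)]

theorem vBr_empty_odd (n l : ℕ) :
    vBr K mx v n ∅ (n + 2 * l + 1) =
      -(mX mx (Finset.Ico n (n + 2 * l + 1)) * v (n + 2 * l + 2)) := by
  induction l generalizing n with
  | zero => simp [vBr, mX_empty, P.v_mul_v_succ, mX_singleton]
  | succ l ih =>
    rw [P.vBr_step K (by omega) (by simp), mX_Ico_add_two',
      show n + 2 * (l + 1) = n + 2 + 2 * l by ring, ih, mul_neg, mul_assoc (mx n * _)]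

theorem vBr_union {n m : ℕ} {S Q : Finset ℕ} (hS : ∀ i ∈ S, i < n) (hQ : ∀ i ∈ Q, n ≤ i) :
    vBr K mx v n (S ∪ Q) m = (-1 : K) ^ S.card • (mX mx S * vBr K mx v n Q m) := by
  have hlt : ∀ p ∈ S, ∀ q ∈ Q, p < q := fun p hp q hq => (hS p hp).trans_le (hQ q hq)
  have hd : Disjoint S Q := Finset.disjoint_left.2 fun i hi hi' => lt_irrefl _ (hlt i hi i hi')
  rw [vBr, vBr, mX_union_of_lt hlt, Finset.card_union_of_disjoint hd, mul_add, smul_add,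
    ← mul_assoc, ← mul_assoc, P.v_mul_mX K hS, pow_add]
  simp [mul_assoc, smul_smul]

/-- The letters of `S` lie below both pivots, so they can be moved to the far left at the cost of a
sign. This leaves the bracket with a bare pivot. -/
theorem mBr_eq {n m : ℕ} {S T : Finset ℕ} (hS : ∀ i ∈ S, i < n) (hnm : n ≤ m) :
    mBr K mx v (S, n) (T, m) = mX mx S * vBr K mx v n T m := by
  have h : mX mx T * v m * (mX mx S * v n) =
      (-1 : K) ^ (S.card + T.card * S.card) • (mX mx S * (mX mx T * v m * v n)) := by
    rw [← mul_assoc, mul_assoc (mX mx T), P.v_mul_mX K fun i hi => (hS i hi).trans_le hnm,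
      mul_smul_comm, smul_mul_assoc, ← mul_assoc, P.mX_mul_mX_comm K, pow_add, mul_smul]
    simp [mul_assoc]
  simp only [mBr, mXv]
  rw [vBr, h, mul_add (mX mx S), smul_smul, ← pow_add, sub_eq_add_neg, ← neg_smul, mul_smul_comm,
    mul_assoc]
  congr 2
  -- Modulo 2, the sign of the supercommutator and the sign of moving `x_S` combine to `|T| + 1`.
  rw [show (S.card + 1) * (T.card + 1) + (S.card + T.card * S.card) =
    2 * (S.card * T.card + S.card) + (T.card + 1) by ring, pow_add, pow_mul, neg_one_sq,
    one_pow, one_mul, pow_succ]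
  simp

end PivotSystem
end Bracket
-- Supercommutators of two monomials, by cases
section Cases

variable (K : Type*) [Field K] {A : Type*} [Ring A] [Algebra K A] {mx d v : ℕ → A}

open Finset

namespace PivotSystem

variable (P : PivotSystem mx d v)

include P

theorem vBr_of_odd (n l : ℕ) {T : Finset ℕ} (hT : T ⊆ range n) :
    SignEq (vBr K mx v n T (n + 2 * l + 1))
      (mX mx (T ∪ Ico n (n + 2 * l + 1)) * v (n + 2 * l + 2)) := by
  have hT' : ∀ i ∈ T, i < n := fun i hi => mem_range.1 (hT hi)
  have h := P.vBr_union K hT' (m := n + 2 * l + 1) (Q := ∅) (by simp)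
  rw [union_empty] at h
  rw [h, P.vBr_empty_odd K, mX_union_of_lt, mul_neg, ← mul_assoc]
  · exact SignEq.smul (SignEq.neg_left .rfl) _
  · intro p hp q hq
    exact (hT' p hp).trans_le (mem_Ico.1 hq).1

theorem vBr_of_even (n l : ℕ) {T : Finset ℕ} (hT : T ⊆ range n) :
    SignEq (vBr K mx v n T (n + 2 * l))
      ((2 : K) • (mX mx (T ∪ (Ico n (n + 2 * l) ∪ {n + 2 * l + 1})) * v (n + 2 * l + 2))) := by
  have hT' : ∀ i ∈ T, i < n := fun i hi => mem_range.1 (hT hi)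
  have h := P.vBr_union K hT' (m := n + 2 * l) (Q := ∅) (by simp)
  rw [union_empty] at h
  rw [h, P.vBr_empty_even K, mX_union_of_lt, mX_union_of_lt, mX_singleton, mul_smul_comm, ← mul_assoc,
    ← mul_assoc, ← mul_assoc]
  · exact SignEq.smul .rfl _
  · intro p hp q hq
    rw [mem_singleton.1 hq]
    have := (mem_Ico.1 hp).2
    omega
  · intro p hp q hq
    refine (hT' p hp).trans_le ?_
    rcases mem_union.1 hq with hq | hq
    · exact (mem_Ico.1 hq).1
    · rw [mem_singleton.1 hq]; omega

/-- Letters below `n` supercommute with `v_n` and are pulled out first. Then the term of the series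
of `v_n` ending in `∂_{n+2l}` is the one that acts. -/
theorem vBr_of_min {n m l : ℕ} {T : Finset ℕ} (hm : T ⊆ range m) (hl : n + 2 * l ∈ T)
    (hmin : ∀ t ∈ T, n ≤ t → n + 2 * l ≤ t) :
    SignEq (vBr K mx v n T m) (mX mx (Ico n (n + 2 * l) ∪ T.erase (n + 2 * l)) * v m) := by
  set Q := T.filter (n + 2 * l < ·) with hQ
  set R := T.filter (· < n) with hR
  have hR' : ∀ i ∈ R, i < n := fun i hi => (mem_filter.1 hi).2
  have hQ' : ∀ i ∈ Q, n + 2 * l < i := fun i hi => (mem_filter.1 hi).2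
  have h1 : T = R ∪ insert (n + 2 * l) Q := by
    ext i
    simp only [hQ, hR, mem_union, mem_insert, mem_filter]
    constructor
    · intro hi
      have := hmin i hi
      by_cases h : i < n
      · exact .inl ⟨hi, h⟩
      · have h' := this (by omega)
        rcases h'.eq_or_lt with h' | h'
        exacts [.inr (.inl h'.symm), .inr (.inr ⟨hi, h'⟩)]
    · rintro (h | rfl | h)
      exacts [h.1, hl, h.1]
  have h2 : Ico n (n + 2 * l) ∪ T.erase (n + 2 * l) = R ∪ (Ico n (n + 2 * l) ∪ Q) := by
    ext i
    simp only [hQ, hR, mem_union, mem_erase, mem_filter, mem_Ico]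
    constructor
    · rintro (hi | ⟨h, hi⟩)
      · exact .inr (.inl hi)
      · have := hmin i hi
        by_cases h' : i < n
        · exact .inl ⟨hi, h'⟩
        · exact .inr (.inr ⟨hi, by have := this (by omega); omega⟩)
    · rintro (h | h | h)
      exacts [.inr ⟨by omega, h.1⟩, .inl h, .inr ⟨by omega, h.1⟩]
  have h3 : n + 2 * l < m := mem_range.1 (hm hl)
  have h4 := P.vBr_union K hR' (m := m) (Q := insert (n + 2 * l) Q) (by
    intro i hi
    rcases mem_insert.1 hi with hi | hi
    · omega
    · have := hQ' i hi; omega)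
  rw [← h1] at h4
  rw [h4, P.vBr_even K l h3 hQ', h2, mX_union_of_lt, mX_union_of_lt, mul_assoc, mul_assoc]
  · exact SignEq.smul .rfl _
  · intro p hp q hq
    exact (mem_Ico.1 hp).2.trans (hQ' q hq)
  · intro p hp q hq
    refine (hR' p hp).trans_le ?_
    rcases mem_union.1 hq with hq | hq
    · exact (mem_Ico.1 hq).1
    · have := hQ' q hq; omega

theorem vBr_of_min_odd {n m l : ℕ} {T : Finset ℕ} (hm : T ⊆ range m) (hl : n + 2 * l + 1 ∈ T)
    (hmin : ∀ t ∈ T, n ≤ t → n + 2 * l + 1 ≤ t) : vBr K mx v n T m = 0 := by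
  set Q := T.filter (n + 2 * l + 1 < ·) with hQ
  set R := T.filter (· < n) with hR
  have hR' : ∀ i ∈ R, i < n := fun i hi => (mem_filter.1 hi).2
  have hQ' : ∀ i ∈ Q, n + 2 * l + 1 < i := fun i hi => (mem_filter.1 hi).2
  have h1 : T = R ∪ insert (n + 2 * l + 1) Q := by
    ext i
    simp only [hQ, hR, mem_union, mem_insert, mem_filter]
    constructor
    · intro hi
      have := hmin i hi
      by_cases h : i < n
      · exact .inl ⟨hi, h⟩
      · have h' := this (by omega)
        rcases h'.eq_or_lt with h' | h'
        exacts [.inr (.inl h'.symm), .inr (.inr ⟨hi, h'⟩)]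
    · rintro (h | rfl | h)
      exacts [h.1, hl, h.1]
  have h4 := P.vBr_union K hR' (m := m) (Q := insert (n + 2 * l + 1) Q) (by
    intro i hi
    rcases mem_insert.1 hi with hi | hi
    · omega
    · have := hQ' i hi; omega)
  rw [← h1] at h4
  rw [h4, P.vBr_odd K l (mem_range.1 (hm hl)) hQ', mul_zero, smul_zero]

theorem mBr_signEq {n m k : ℕ} {S T U : Finset ℕ} (hS : S ⊆ range n) (hnm : n ≤ m)
    (h : SignEq (vBr K mx v n T m) (mX mx U * v k)) (hd : Disjoint S U) :
    SignEq (mBr K mx v (S, n) (T, m)) (mXv mx v (S ∪ U, k)) := by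
  rw [P.mBr_eq K (fun i hi => mem_range.1 (hS hi)) hnm, mXv]
  refine (h.mul_left _).trans ?_
  rw [← mul_assoc]
  exact (P.mX_mul_mX hd).mul_right _

theorem mBr_eq_zero {n m k : ℕ} {S T U : Finset ℕ} (hS : S ⊆ range n) (hnm : n ≤ m)
    (h : SignEq (vBr K mx v n T m) (mX mx U * v k)) (hd : ¬ Disjoint S U) :
    mBr K mx v (S, n) (T, m) = 0 := by
  rw [P.mBr_eq K (fun i hi => mem_range.1 (hS hi)) hnm]
  refine (h.mul_left _).eq_zero ?_
  rw [← mul_assoc, P.mX_mul_mX_of_not_disjoint hd, zero_mul]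

theorem mBr_of_even {n l : ℕ} {S T : Finset ℕ} (hS : S ⊆ range n) (hT : T ⊆ range n)
    (hd : Disjoint S T) :
    SignEq (mBr K mx v (S, n) (T, n + 2 * l))
      ((2 : K) • mXv mx v (S ∪ (T ∪ (Ico n (n + 2 * l) ∪ {n + 2 * l + 1})), n + 2 * l + 2)) := by
  rw [P.mBr_eq K (fun i hi => mem_range.1 (hS hi)) (by omega), mXv]
  refine ((P.vBr_of_even K n l hT).mul_left _).trans ?_
  rw [mul_smul_comm, ← mul_assoc, two_smul, two_smul, ← two_mul, ← two_mul]
  refine ((P.mX_mul_mX ?_).mul_right _).mul_left _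
  rw [disjoint_union_right, disjoint_left (t := Ico _ _ ∪ _)]
  refine ⟨hd, fun i hi hi' => ?_⟩
  have := mem_range.1 (hS hi)
  simp only [mem_union, mem_Ico, mem_singleton] at hi'
  omega

theorem mBr_of_even_eq_zero {n l : ℕ} {S T : Finset ℕ} (hS : S ⊆ range n) (hT : T ⊆ range n)
    (hd : ¬ Disjoint S T) : mBr K mx v (S, n) (T, n + 2 * l) = 0 := by
  rw [P.mBr_eq K (fun i hi => mem_range.1 (hS hi)) (by omega)]
  refine ((P.vBr_of_even K n l hT).mul_left _).eq_zero ?_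
  rw [mul_smul_comm, ← mul_assoc, P.mX_mul_mX_of_not_disjoint, zero_mul, smul_zero]
  exact fun h => hd (disjoint_union_right.1 h).1

/-- The cases are decided by whether `T` has a letter of index at least `n`, and by the parity of `m
- n` or of the offset of the smallest such letter. A repeated letter always gives zero. -/
theorem mBr_cases {n m : ℕ} {S T : Finset ℕ} (hS : S ⊆ range n) (hT : T ⊆ range m)
    (hnm : n ≤ m) :
    mBr K mx v (S, n) (T, m) = 0 ∨
    (∃ l, m = n + 2 * l + 1 ∧ T ⊆ range n ∧ Disjoint S T ∧
      SignEq (mBr K mx v (S, n) (T, m)) (mXv mx v (S ∪ (T ∪ Ico n m), m + 1))) ∨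
    (∃ l, m = n + 2 * l ∧ T ⊆ range n ∧ Disjoint S T ∧
      SignEq (mBr K mx v (S, n) (T, m))
        ((2 : K) • mXv mx v (S ∪ (T ∪ (Ico n m ∪ {m + 1})), m + 2))) ∨
    (∃ l, n + 2 * l ∈ T ∧ (∀ t ∈ T, n ≤ t → n + 2 * l ≤ t) ∧ Disjoint S (T.erase (n + 2 * l)) ∧
      SignEq (mBr K mx v (S, n) (T, m))
        (mXv mx v (S ∪ (Ico n (n + 2 * l) ∪ T.erase (n + 2 * l)), m))) := by
  by_cases hTn : T ⊆ range n
  · obtain ⟨c, rfl⟩ := Nat.exists_eq_add_of_le hnm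
    rcases Nat.even_or_odd' c with ⟨l, rfl | rfl⟩
    · by_cases hd : Disjoint S T
      · exact .inr (.inr (.inl ⟨l, rfl, hTn, hd, P.mBr_of_even K hS hTn hd⟩))
      · exact .inl (P.mBr_of_even_eq_zero K hS hTn hd)
    · by_cases hd : Disjoint S T
      · refine .inr (.inl ⟨l, rfl, hTn, hd, P.mBr_signEq K hS hnm (P.vBr_of_odd K n l hTn) ?_⟩)
        rw [disjoint_union_right, disjoint_left (t := Ico _ _)]
        refine ⟨hd, fun i hi hi' => ?_⟩
        have := mem_range.1 (hS hi)
        have := (mem_Ico.1 hi').1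
        omega
      · exact .inl (P.mBr_eq_zero K hS hnm (P.vBr_of_odd K n l hTn)
          fun h => hd (disjoint_union_right.1 h).1)
  · have hne : (T.filter (n ≤ ·)).Nonempty := by
      obtain ⟨t, ht, ht'⟩ := not_subset.1 hTn
      exact ⟨t, mem_filter.2 ⟨ht, not_lt.1 fun h => ht' (mem_range.2 h)⟩⟩
    obtain ⟨ht, hnt⟩ := mem_filter.1 (min'_mem _ hne)
    have hmin : ∀ s ∈ T, n ≤ s → (T.filter (n ≤ ·)).min' hne ≤ s :=
      fun s hs hns => min'_le _ _ (mem_filter.2 ⟨hs, hns⟩)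
    generalize (T.filter (n ≤ ·)).min' hne = t at ht hnt hmin
    obtain ⟨c, rfl⟩ := Nat.exists_eq_add_of_le hnt
    rcases Nat.even_or_odd' c with ⟨l, rfl | rfl⟩
    · by_cases hd : Disjoint S (T.erase (n + 2 * l))
      · refine .inr (.inr (.inr ⟨l, ht, hmin, hd,
          P.mBr_signEq K hS hnm (P.vBr_of_min K hT ht hmin) ?_⟩))
        rw [disjoint_union_right, disjoint_left (t := Ico _ _)]
        refine ⟨fun i hi hi' => ?_, hd⟩
        have := mem_range.1 (hS hi)
        have := (mem_Ico.1 hi').1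
        omega
      · exact .inl (P.mBr_eq_zero K hS hnm (P.vBr_of_min K hT ht hmin)
          fun h => hd (disjoint_union_right.1 h).2)
    · left
      rw [P.mBr_eq K (fun i hi => mem_range.1 (hS hi)) hnm, P.vBr_of_min_odd K hT ht hmin, mul_zero]

-- Moving `v_n` past `x_S` makes every letter of `S` appear twice, so only bare pivots have a
-- nonzero square.
include K in
theorem mXv_mul_self {n : ℕ} {S : Finset ℕ} (hS : S ⊆ range n) :
    mXv mx v (S, n) * mXv mx v (S, n) = if S = ∅ then mXv mx v ({n + 1}, n + 2) else 0 := by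
  split_ifs with h
  · subst h
    simp [mXv, mX_empty, mX_singleton, P.v_mul_v_self]
  · simp only [mXv]
    rw [mul_assoc, ← mul_assoc (v n), P.v_mul_mX K fun i hi => mem_range.1 (hS hi), smul_mul_assoc,
      mul_smul_comm, mul_assoc, ← mul_assoc, P.mX_mul_mX_of_not_disjoint, zero_mul, smul_zero]
    rwa [disjoint_self]

omit P in
theorem mBr_swap (i j : Finset ℕ × ℕ) : SignEq (mBr K mx v i j) (mBr K mx v j i) := by
  simp only [mBr, mul_comm (j.1.card + 1)]
  rcases neg_one_pow_eq_or K ((i.1.card + 1) * (j.1.card + 1)) with h | h <;> rw [h]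
  · right; simp
  · left; simp [add_comm]

end PivotSystem
end Cases
-- Degrees and the index sets of the bases
section Degrees

open Finset

/-- The degrees `1, 1, 3, 5, 11, 21, …` of the pivot elements. -/
def dg : ℕ → ℕ
  | 0 => 1
  | 1 => 1
  | n + 2 => dg (n + 1) + 2 * dg n

theorem dg_add_two (n : ℕ) : dg (n + 2) = dg (n + 1) + 2 * dg n := rfl

theorem dg_pos (n : ℕ) : 0 < dg n := by
  induction n using dg.induct with
  | case1 => decide
  | case2 => decide
  | case3 n h1 h2 => rw [dg_add_two]; omega

theorem dg_succ_even (n : ℕ) : dg (2 * n + 1) + 1 = 2 * dg (2 * n) ∧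
    dg (2 * n + 2) = 2 * dg (2 * n + 1) + 1 := by
  induction n with
  | zero => decide
  | succ n ih =>
    have h1 := dg_add_two (2 * n)
    have h2 := dg_add_two (2 * n + 1)
    have h3 := dg_add_two (2 * n + 2)
    simp only [mul_add, mul_one, Nat.add_assoc, Nat.reduceAdd] at *
    omega

/-- The sum telescopes because `dg (k + 2) - dg k = dg (k + 1) + dg k`. It says that all terms of
the series of `v_n` have the same degree. -/
theorem sum_Ico_even (n l : ℕ) : ∑ i ∈ Ico n (n + 2 * l), dg i + dg n = dg (n + 2 * l) := by
  induction l with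
  | zero => simp
  | succ l ih =>
    rw [show n + 2 * (l + 1) = n + 2 * l + 1 + 1 by ring, sum_Ico_succ_top (by omega),
      sum_Ico_succ_top (by omega), dg_add_two]
    omega

theorem sum_range_dg (m : ℕ) :
    ∑ i ∈ range (2 * m), dg i + 1 = dg (2 * m) ∧ ∑ i ∈ range (2 * m + 1), dg i = dg (2 * m + 1) := by
  have h := sum_Ico_even 0 m
  rw [zero_add, Nat.Ico_zero_eq_range] at h
  have h' := (dg_succ_even m).1
  rw [sum_range_succ]
  simp only [dg] at h
  omega

theorem sum_range_dg_le (m : ℕ) : ∑ i ∈ range m, dg i ≤ dg m := by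
  rcases Nat.even_or_odd' m with ⟨l, rfl | rfl⟩
  · have := (sum_range_dg l).1; omega
  · exact (sum_range_dg l).2.le

theorem sum_dg_le {S : Finset ℕ} {m : ℕ} (h : S ⊆ range m) : ∑ i ∈ S, dg i ≤ dg m :=
  (sum_le_sum_of_subset h).trans (sum_range_dg_le m)

/-- The degree of `x_S v_n`. -/
def mDeg (i : Finset ℕ × ℕ) : ℕ := dg i.2 - ∑ j ∈ i.1, dg j

/-- For these indices the truncated subtraction in the degree is a true one. -/
theorem mDeg_add {S : Finset ℕ} {n : ℕ} (h : S ⊆ range n) :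
    mDeg (S, n) + ∑ j ∈ S, dg j = dg n :=
  Nat.sub_add_cancel (sum_dg_le h)

/-- The indices of the monomials `x_S v_n` with `S ⊆ {0, …, n - 2}`. -/
def indLie : Set (Finset ℕ × ℕ) := {i | i.1 ⊆ range (i.2 - 1)}

/-- The indices of the monomials in `indLie` and of the squares `x_{n+1} v_{n+2}` of the pivot
elements. -/
def indChar2 : Set (Finset ℕ × ℕ) := indLie ∪ {i | ∃ m, i = ({m + 1}, m + 2)}

/-- The indices of the monomials in `indLie` and of the monomials `x_S x_{m+1} v_{m+2}` with
`S ⊆ {0, …, m - 1}`, with the exception of `x_0 x_2 v_3`. -/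
def indSuper : Set (Finset ℕ × ℕ) :=
  indLie ∪ {i | i ≠ ({0, 2}, 3) ∧ ∃ m, ∃ S ⊆ range m, i = (insert (m + 1) S, m + 2)}

theorem indChar2_subset : indChar2 ⊆ indSuper := by
  rintro i (h | ⟨m, rfl⟩)
  · exact .inl h
  · refine .inr ⟨fun h => ?_, m, ∅, by simp, by simp⟩
    have := congrArg (fun i => i.1.card) h
    simp at this

theorem subset_of_mem_indSuper {S : Finset ℕ} {n : ℕ} (h : (S, n) ∈ indSuper) : S ⊆ range n := by
  rcases h with h | ⟨-, m, T, hT, h⟩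
  · exact h.trans (range_subset_range.2 (Nat.sub_le _ _))
  · obtain ⟨rfl, rfl⟩ := Prod.mk.inj h
    intro i hi
    rcases mem_insert.1 hi with rfl | hi
    · simp
    · have := mem_range.1 (hT hi)
      simp only [mem_range]; omega

theorem mDeg_pos {i : Finset ℕ × ℕ} (h : i ∈ indSuper) : 0 < mDeg i := by
  rw [mDeg]
  rcases h with h | ⟨-, m, T, hT, rfl⟩
  · obtain ⟨S, n⟩ := i
    have h1 := sum_dg_le h
    rcases n with _ | _ | n
    · obtain rfl : S = ∅ := by simpa [indLie] using h
      decide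
    · obtain rfl : S = ∅ := by simpa [indLie] using h
      decide
    · have : dg (n + 1 + 1) = _ := dg_add_two n
      have := dg_pos n
      simp only [Nat.add_sub_cancel] at h1 ⊢
      omega
  · have hm : m + 1 ∉ T := fun h => by have := mem_range.1 (hT h); omega
    have := dg_add_two m
    have := dg_pos m
    have := sum_dg_le hT
    simp only [sum_insert hm]
    omega

theorem mDeg_odd {n l : ℕ} {S T : Finset ℕ} (hS : S ⊆ range n) (hT : T ⊆ range n)
    (hd : Disjoint S T) :
    mDeg (S ∪ (T ∪ Ico n (n + 2 * l + 1)), n + 2 * l + 1 + 1) =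
      mDeg (S, n) + mDeg (T, n + 2 * l + 1) := by
  have hI : ∀ U ⊆ range n, Disjoint U (Ico n (n + 2 * l + 1)) := fun U hU =>
    disjoint_left.2 fun i hi hi' => by
      have := mem_range.1 (hU hi)
      have := (mem_Ico.1 hi').1
      omega
  have h0 : T ⊆ range (n + 2 * l + 1) := hT.trans (range_subset_range.2 (by omega))
  have h1 := mDeg_add hS
  have h2 := mDeg_add h0
  have h3 := sum_Ico_even n l
  have h4 : dg (n + 2 * l + 1 + 1) = _ := dg_add_two (n + 2 * l)
  rw [mDeg, sum_union (disjoint_union_right.2 ⟨hd, hI S hS⟩), sum_union (hI T hT),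
    sum_Ico_succ_top (by omega)]
  simp only
  omega

theorem mDeg_even {n l : ℕ} {S T : Finset ℕ} (hS : S ⊆ range n) (hT : T ⊆ range n)
    (hd : Disjoint S T) :
    mDeg (S ∪ (T ∪ (Ico n (n + 2 * l) ∪ {n + 2 * l + 1})), n + 2 * l + 2) =
      mDeg (S, n) + mDeg (T, n + 2 * l) := by
  have hI : ∀ U ⊆ range n, Disjoint U (Ico n (n + 2 * l) ∪ {n + 2 * l + 1}) := fun U hU =>
    disjoint_left.2 fun i hi hi' => by
      have := mem_range.1 (hU hi)
      simp only [mem_union, mem_Ico, mem_singleton] at hi'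
      omega
  have h0 : T ⊆ range (n + 2 * l) := hT.trans (range_subset_range.2 (by omega))
  have h1 := mDeg_add hS
  have h2 := mDeg_add h0
  have h3 := sum_Ico_even n l
  have h4 := dg_add_two (n + 2 * l)
  rw [mDeg, sum_union (disjoint_union_right.2 ⟨hd, hI S hS⟩), sum_union (hI T hT),
    sum_union (by simp), sum_singleton]
  simp only
  omega

theorem mDeg_min {n m l : ℕ} {S T : Finset ℕ} (hS : S ⊆ range n) (hT : T ⊆ range m)
    (hl : n + 2 * l ∈ T) (hmin : ∀ t ∈ T, n ≤ t → n + 2 * l ≤ t)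
    (hd : Disjoint S (T.erase (n + 2 * l))) :
    mDeg (S ∪ (Ico n (n + 2 * l) ∪ T.erase (n + 2 * l)), m) = mDeg (S, n) + mDeg (T, m) := by
  have h1 := mDeg_add hS
  have h2 := mDeg_add hT
  have h3 := sum_Ico_even n l
  have h4 := add_sum_erase T dg hl
  rw [mDeg, sum_union (disjoint_union_right.2 ⟨?_, hd⟩), sum_union ?_]
  · simp only
    omega
  · refine disjoint_left.2 fun i hi hi' => ?_
    have h5 := mem_Ico.1 hi
    have := hmin i (mem_of_mem_erase hi') h5.1
    omega
  · refine disjoint_left.2 fun i hi hi' => ?_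
    have := mem_range.1 (hS hi)
    have := (mem_Ico.1 hi').1
    omega

theorem odd_mem_indLie {n m : ℕ} {S T : Finset ℕ} (hS : S ⊆ range n) (hT : T ⊆ range n)
    (hnm : n ≤ m) : (S ∪ (T ∪ Ico n m), m + 1) ∈ indLie := by
  intro i hi
  simp only [mem_union, mem_Ico] at hi
  simp only [Nat.add_sub_cancel, mem_range]
  rcases hi with hi | hi | hi
  · exact (mem_range.1 (hS hi)).trans_le hnm
  · exact (mem_range.1 (hT hi)).trans_le hnm
  · exact hi.2

theorem even_mem_indSuper {n m : ℕ} {S T : Finset ℕ} (hS : S ⊆ range n) (hT : T ⊆ range n)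
    (hS' : (S, n) ∈ indSuper) (hT' : (T, m) ∈ indSuper) (l : ℕ) (hm : m = n + 2 * l) :
    (S ∪ (T ∪ (Ico n m ∪ {m + 1})), m + 2) ∈ indSuper := by
  have h1 : ∀ U : Finset ℕ, (U, 1) ∈ indSuper → U = ∅ := by
    rintro U (h | ⟨-, m, V, -, h⟩)
    · simpa [indLie] using h
    · simp at h
  refine .inr ⟨fun h => ?_, m, S ∪ (T ∪ Ico n m), fun i hi => ?_, ?_⟩
  · obtain ⟨h2, h3⟩ := Prod.mk.inj h
    -- The excluded `x_0 x_2 v_3` could only come from two monomials of level 1, which have no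
    -- letters, so `x_0` cannot appear.
    obtain rfl : m = 1 := by omega
    obtain rfl : n = 1 := by omega
    rw [h1 S hS', h1 T hT'] at h2
    revert h2
    decide
  · simp only [mem_union, mem_Ico] at hi
    rcases hi with hi | hi | hi
    · exact mem_range.2 ((mem_range.1 (hS hi)).trans_le (by omega))
    · exact mem_range.2 ((mem_range.1 (hT hi)).trans_le (by omega))
    · exact mem_range.2 hi.2
  · ext i <;> simp [or_assoc, or_comm, or_left_comm]

theorem min_mem_indLie {n m l : ℕ} {S T : Finset ℕ} (hS : S ⊆ range n) (hT : (T, m) ∈ indLie)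
    (hl : n + 2 * l ∈ T) :
    (S ∪ (Ico n (n + 2 * l) ∪ T.erase (n + 2 * l)), m) ∈ indLie := by
  have h := mem_range.1 (hT hl)
  intro i hi
  simp only [mem_union, mem_Ico] at hi
  rcases hi with hi | hi | hi
  · have := mem_range.1 (hS hi)
    simp only [mem_range] at *
    omega
  · simp only [mem_range] at *
    omega
  · exact hT (mem_of_mem_erase hi)

/-- Once the top letter `x_{m+1}` is the one replaced, only letters of index at most `m` remain. -/
theorem min_mem_indLie_of_eq {n m l : ℕ} {S T : Finset ℕ} (hS : S ⊆ range n) (hT : T ⊆ range m)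
    (hl : n + 2 * l = m + 1) :
    (S ∪ (Ico n (n + 2 * l) ∪ (insert (m + 1) T).erase (n + 2 * l)), m + 2) ∈ indLie := by
  intro i hi
  simp only [mem_union, mem_Ico, mem_erase, mem_insert] at hi
  simp only [mem_range]
  rcases hi with hi | hi | hi
  · have := mem_range.1 (hS hi)
    omega
  · omega
  · have := mem_range.1 (hT (hi.2.resolve_left (by omega)))
    omega

theorem min_mem_indChar2 {n m l : ℕ} {S T : Finset ℕ} (hS : S ⊆ range n) (hT : (T, m) ∈ indChar2)
    (hl : n + 2 * l ∈ T) :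
    (S ∪ (Ico n (n + 2 * l) ∪ T.erase (n + 2 * l)), m) ∈ indChar2 := by
  rcases hT with hT | ⟨k, hk⟩
  · exact .inl (min_mem_indLie hS hT hl)
  · obtain ⟨rfl, rfl⟩ := Prod.mk.inj hk
    exact .inl (min_mem_indLie_of_eq (T := ∅) hS (by simp) (mem_singleton.1 hl))

theorem min_mem_indSuper {n m l : ℕ} {S T : Finset ℕ} (hS : S ⊆ range n) (hT : (T, m) ∈ indSuper)
    (hl : n + 2 * l ∈ T) :
    (S ∪ (Ico n (n + 2 * l) ∪ T.erase (n + 2 * l)), m) ∈ indSuper := by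
  rcases hT with hT | ⟨hne, k, U, hU, hk⟩
  · exact .inl (min_mem_indLie hS hT hl)
  · obtain ⟨rfl, rfl⟩ := Prod.mk.inj hk
    by_cases h : n + 2 * l = k + 1
    · exact .inl (min_mem_indLie_of_eq hS hU h)
    · have hlU : n + 2 * l ∈ U := (mem_insert.1 hl).resolve_left h
      have hlk := mem_range.1 (hU hlU)
      refine .inr ⟨fun he => ?_, k, S ∪ (Ico n (n + 2 * l) ∪ U.erase (n + 2 * l)), fun i hi => ?_,
        ?_⟩
      · obtain ⟨h2, h3⟩ := Prod.mk.inj he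
        -- Reaching the excluded `x_0 x_2 v_3` would mean bracketing with `v_0`, which removes `x_0`
        -- and puts nothing in its place.
        obtain rfl : k = 1 := by omega
        obtain rfl : n = 0 := by omega
        obtain rfl : l = 0 := by omega
        have : 0 ∈ S ∪ (Ico 0 (0 + 2 * 0) ∪ (insert (1 + 1) U).erase (0 + 2 * 0)) := by
          rw [h2]; simp
        have h0 := subset_empty.1 hS
        simp [h0] at this
      · simp only [mem_union, mem_Ico, mem_erase] at hi
        rcases hi with hi | hi | hi
        · have := mem_range.1 (hS hi)
          simp only [mem_range]; omega
        · simp only [mem_range]; omega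
        · exact hU hi.2
      · congr 1
        rw [erase_insert_of_ne (Ne.symm h), union_insert, union_insert]

end Degrees

/-! ### The index sets are closed under supercommutators -/

section Closure

open Finset

variable (K : Type*) [Field K] {A : Type*} [Ring A] [Algebra K A] {mx d v : ℕ → A}

/-- Supercommutators of the monomials in `I` are scalar multiples of monomials in `I`. -/
def BrClosed (mx v : ℕ → A) (I : Set (Finset ℕ × ℕ)) : Prop :=
  ∀ i ∈ I, ∀ j ∈ I, mBr K mx v i j = 0 ∨
    ∃ k ∈ I, mDeg k = mDeg i + mDeg j ∧ ∃ c : K, mBr K mx v i j = c • mXv mx v k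

variable {K}

theorem brClosed_of_le {I : Set (Finset ℕ × ℕ)}
    (h : ∀ i ∈ I, ∀ j ∈ I, i.2 ≤ j.2 → mBr K mx v i j = 0 ∨
      ∃ k ∈ I, mDeg k = mDeg i + mDeg j ∧ ∃ c : K, mBr K mx v i j = c • mXv mx v k) :
    BrClosed K mx v I := by
  intro i hi j hj
  rcases le_total i.2 j.2 with hij | hij
  · exact h i hi j hj hij
  · have hs := PivotSystem.mBr_swap K (mx := mx) (v := v) i j
    rcases h j hj i hi hij with h0 | ⟨k, hk, hdeg, c, hc⟩
    · exact .inl (hs.eq_zero h0)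
    · refine .inr ⟨k, hk, by rw [hdeg, add_comm], ?_⟩
      obtain ⟨c', -, hc'⟩ := hs.exists_smul K
      exact ⟨c' * c, by rw [hc', hc, smul_smul]⟩

namespace PivotSystem

variable (P : PivotSystem mx d v)

include P

/-- Only the case with factor 2 can produce a new letter directly below the new pivot; it vanishes
in characteristic 2 and otherwise requires the largest set. The replacement case is left as a
hypothesis because the three sets treat it differently. -/
theorem brClosed_aux {I : Set (Finset ℕ × ℕ)} (hI : I ⊆ indSuper) (hLie : indLie ⊆ I)
    (heven : ((2 : K) = 0) ∨ I = indSuper)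
    (hmin : ∀ {n m l : ℕ} {S T : Finset ℕ}, S ⊆ range n → (T, m) ∈ I → n + 2 * l ∈ T →
      (S ∪ (Ico n (n + 2 * l) ∪ T.erase (n + 2 * l)), m) ∈ I) :
    BrClosed K mx v I := by
  refine brClosed_of_le ?_
  rintro ⟨S, n⟩ hi ⟨T, m⟩ hj hnm
  have hS := subset_of_mem_indSuper (hI hi)
  have hT := subset_of_mem_indSuper (hI hj)
  rcases P.mBr_cases K hS hT hnm with h | ⟨l, rfl, hTn, hd, h⟩ | ⟨l, rfl, hTn, hd, h⟩ |
    ⟨l, hl, hl', hd, h⟩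
  · exact .inl h
  · obtain ⟨c, -, hc⟩ := h.exists_smul K
    exact .inr ⟨_, hLie (odd_mem_indLie hS hTn hnm), mDeg_odd hS hTn hd, c, hc⟩
  · rcases heven with h2 | rfl
    · left
      exact h.eq_zero (by rw [h2, zero_smul])
    · obtain ⟨c, -, hc⟩ := h.exists_smul K
      rw [smul_smul] at hc
      exact .inr ⟨_, even_mem_indSuper hS hTn hi hj l rfl, mDeg_even hS hTn hd, _, hc⟩
  · obtain ⟨c, -, hc⟩ := h.exists_smul K
    exact .inr ⟨_, hmin hS hj hl, mDeg_min hS hT hl hl' hd, c, hc⟩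

theorem brClosed_indLie (h : (2 : K) = 0) : BrClosed K mx v indLie :=
  P.brClosed_aux (Set.subset_union_left) subset_rfl (.inl h) min_mem_indLie

theorem brClosed_indChar2 (h : (2 : K) = 0) : BrClosed K mx v indChar2 :=
  P.brClosed_aux indChar2_subset Set.subset_union_left (.inl h) min_mem_indChar2

theorem brClosed_indSuper : BrClosed K mx v indSuper :=
  P.brClosed_aux subset_rfl Set.subset_union_left (.inr rfl) min_mem_indSuper

end PivotSystem
end Closure
-- The monomials are obtained from the generators
section Generation

open Finset

variable (K : Type*) [Field K] {A : Type*} [Ring A] [Algebra K A] {mx d v : ℕ → A}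

/-- The monomial with index `i` is a multiple of a supercommutator of a generator with a monomial
in `I`. -/
def GenBr (mx v : ℕ → A) (I : Set (Finset ℕ × ℕ)) (i : Finset ℕ × ℕ) : Prop :=
  ∃ e < 2, ∃ j ∈ I, mDeg i = mDeg j + 1 ∧ ∃ c : K, mXv mx v i = c • mBr K mx v (∅, e) j

theorem mDeg_generator {e : ℕ} (he : e < 2) : mDeg (∅, e) = 1 := by
  interval_cases e <;> rfl

variable {K}

theorem GenBr.mono {I J : Set (Finset ℕ × ℕ)} (h : I ⊆ J) {i : Finset ℕ × ℕ}
    (hi : GenBr K mx v I i) : GenBr K mx v J i := by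
  obtain ⟨e, he, j, hj, hdeg, c, hc⟩ := hi
  exact ⟨e, he, j, h hj, hdeg, c, hc⟩

theorem genBr_of_signEq {I : Set (Finset ℕ × ℕ)} {i j : Finset ℕ × ℕ} {e : ℕ} (he : e < 2)
    (hj : j ∈ I) (hdeg : mDeg i = mDeg (∅, e) + mDeg j) {c : K} (hc : c ≠ 0)
    (h : SignEq (mBr K mx v (∅, e) j) (c • mXv mx v i)) : GenBr K mx v I i := by
  refine ⟨e, he, j, hj, by rw [hdeg, mDeg_generator he, add_comm], ?_⟩
  obtain ⟨c', hc', h'⟩ := h.exists_smul K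
  refine ⟨(c' * c)⁻¹, ?_⟩
  rw [h', smul_smul c' c, smul_smul, inv_mul_cancel₀ (mul_ne_zero hc' hc), one_smul]

theorem genBr_of_signEq_one {I : Set (Finset ℕ × ℕ)} {i j : Finset ℕ × ℕ} {e : ℕ} (he : e < 2)
    (hj : j ∈ I) (hdeg : mDeg i = mDeg (∅, e) + mDeg j)
    (h : SignEq (mBr K mx v (∅, e) j) (mXv mx v i)) : GenBr K mx v I i :=
  genBr_of_signEq he hj hdeg one_ne_zero (by rwa [one_smul])

/-- The first missing letter is written as `e + 2l` because `v_0` removes letters of even index and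
`v_1` those of odd index. -/
theorem exists_first_notMem (S : Finset ℕ) :
    ∃ e < 2, ∃ l, e + 2 * l ∉ S ∧ ∀ i < e + 2 * l, i ∈ S := by
  classical
  obtain ⟨j, hj, hmin⟩ : ∃ j, j ∉ S ∧ ∀ i < j, i ∈ S :=
    ⟨Nat.find (Infinite.exists_notMem_finset S), Nat.find_spec (Infinite.exists_notMem_finset S),
      fun i hi => not_not.1 (Nat.find_min (Infinite.exists_notMem_finset S) hi)⟩
  refine ⟨j % 2, Nat.mod_lt _ two_pos, j / 2, ?_, ?_⟩ <;> rwa [Nat.mod_add_div]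

theorem insert_sdiff_eq {S : Finset ℕ} {e l : ℕ} (h : e + 2 * l ∉ S)
    (hall : ∀ i < e + 2 * l, i ∈ S) :
    ∅ ∪ (Ico e (e + 2 * l) ∪
      (insert (e + 2 * l) (S \ Ico e (e + 2 * l))).erase (e + 2 * l)) = S := by
  ext i
  simp only [empty_union, mem_union, mem_Ico, mem_erase, mem_insert, mem_sdiff]
  have := hall i
  by_cases hi : i = e + 2 * l
  · subst hi; simp [h]
  · constructor
    · rintro (h | h)
      · exact this h.2
      · exact (h.2.resolve_left hi).1
    · intro h
      by_cases h' : e ≤ i ∧ i < e + 2 * l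
      exacts [.inl h', .inr ⟨hi, .inr ⟨h, h'⟩⟩]

namespace PivotSystem

variable (P : PivotSystem mx d v)

include P

/-- The replacement rule is read backwards: trading the block `x_e ⋯ x_{e+2l-1}` of `S` for the
missing letter `x_{e+2l}` gives a monomial that `v_e` sends back to `x_S v_k`. -/
theorem genBr_of_notMem {I : Set (Finset ℕ × ℕ)} {S : Finset ℕ} {e l k : ℕ} (he : e < 2)
    (hS : S ⊆ range k) (hk : e + 2 * l < k) (h : e + 2 * l ∉ S) (hall : ∀ i < e + 2 * l, i ∈ S)
    (hI : (insert (e + 2 * l) (S \ Ico e (e + 2 * l)), k) ∈ I) : GenBr K mx v I (S, k) := by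
  have hT : insert (e + 2 * l) (S \ Ico e (e + 2 * l)) ⊆ range k :=
    insert_subset (mem_range.2 hk) (sdiff_subset.trans hS)
  have hl : e + 2 * l ∈ insert (e + 2 * l) (S \ Ico e (e + 2 * l)) := mem_insert_self _ _
  have hmin : ∀ t ∈ insert (e + 2 * l) (S \ Ico e (e + 2 * l)), e ≤ t → e + 2 * l ≤ t := by
    intro t ht het
    rcases mem_insert.1 ht with rfl | ht
    · exact le_rfl
    · by_contra hlt
      exact (mem_sdiff.1 ht).2 (mem_Ico.2 ⟨het, not_le.1 hlt⟩)
  have hb := P.mBr_signEq K (S := ∅) (by simp) (by omega) (P.vBr_of_min K hT hl hmin) (by simp)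
  have hdeg := mDeg_min (S := ∅) (by simp) hT hl hmin (by simp)
  rw [insert_sdiff_eq h hall] at hb hdeg
  exact genBr_of_signEq_one he hI hdeg hb

theorem genBr_indLie {S : Finset ℕ} {k : ℕ} (hS : (S, k) ∈ indLie) (hk : 2 ≤ k) :
    GenBr K mx v indLie (S, k) := by
  have hS' : S ⊆ range (k - 1) := hS
  obtain ⟨m, rfl⟩ := Nat.exists_eq_add_of_le' hk
  obtain ⟨e, he, l, h, hall⟩ := exists_first_notMem S
  by_cases hlt : e + 2 * l < m + 1
  · refine P.genBr_of_notMem he (subset_of_mem_indSuper (.inl hS)) (by omega) h hall ?_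
    exact insert_subset (mem_range.2 hlt) (sdiff_subset.trans hS')
  · have hSeq : S = range (m + 1) :=
      subset_antisymm hS' fun i hi => hall i ((mem_range.1 hi).trans_le (not_lt.1 hlt))
    rcases Nat.even_or_odd' m with ⟨q, rfl | rfl⟩
    -- With no letter missing, the monomial is `[v_0, v_{2q+1}]` up to sign, or `[v_1, x_0
    -- v_{2q+2}]` in the other parity.
    · have e1 : ∅ ∪ (∅ ∪ Ico 0 (0 + 2 * q + 1)) = S := by
        rw [hSeq]; simp
      have h1 := P.mBr_signEq K (S := ∅) (subset_refl _) (by omega)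
        (P.vBr_of_odd K 0 q (T := ∅) (by simp)) (by simp)
      have h2 := mDeg_odd (n := 0) (l := q) (S := ∅) (T := ∅) (by simp) (by simp) (by simp)
      rw [e1] at h1 h2
      simp only [zero_add, add_assoc, Nat.reduceAdd] at h1 h2
      exact genBr_of_signEq_one (by omega) (by simp [indLie]) h2 h1
    · have e1 : ∅ ∪ ({0} ∪ Ico 1 (1 + 2 * q + 1)) = S := by
        rw [hSeq]; ext i; simp; omega
      have h1 := P.mBr_signEq K (S := ∅) (by simp) (by omega)
        (P.vBr_of_odd K 1 q (T := {0}) (by simp)) (by simp)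
      have h2 := mDeg_odd (n := 1) (l := q) (S := ∅) (T := {0}) (by simp) (by simp) (by simp)
      rw [e1, show 1 + 2 * q + 1 = 2 * q + 2 by ring] at h2
      rw [e1, show 1 + 2 * q + 2 = 2 * q + 1 + 2 by ring,
        show 1 + 2 * q + 1 = 2 * q + 2 by ring] at h1
      exact genBr_of_signEq_one (by omega) (by simp [indLie]) h2 h1

theorem genBr_indSuper (h2 : (2 : K) ≠ 0) {S : Finset ℕ} {k : ℕ} (hS : (S, k) ∈ indSuper)
    (hk : 2 ≤ k) : GenBr K mx v indSuper (S, k) := by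
  have hSk := subset_of_mem_indSuper hS
  rcases hS with hS | ⟨hne, m, U, hU, hi⟩
  · exact (P.genBr_indLie hS hk).mono Set.subset_union_left
  obtain ⟨rfl, rfl⟩ := Prod.mk.inj hi
  obtain ⟨e, he, l, h, hall⟩ := exists_first_notMem U
  by_cases hlt : e + 2 * l < m
  -- For `x_2 v_3` the general preimage would be the excluded `x_0 x_2 v_3`; instead `[v_1, v_1] = 2
  -- x_2 v_3` is used.
  · by_cases hm : m = 1 ∧ U = ∅
    · obtain ⟨rfl, rfl⟩ := hm
      have h1 := P.mBr_of_even K (n := 1) (l := 0) (S := ∅) (T := ∅) (by simp) (by simp) (by simp)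
      exact genBr_of_signEq one_lt_two (.inl (by simp [indLie])) (by decide) h2 h1
    · refine P.genBr_of_notMem he hSk (by omega) ?_ (fun i hi => mem_insert_of_mem (hall i hi)) ?_
      · rw [mem_insert, not_or]
        exact ⟨by omega, h⟩
      · refine .inr ⟨fun heq => hm ?_, m, insert (e + 2 * l) (U \ Ico e (e + 2 * l)),
          insert_subset (mem_range.2 hlt) (sdiff_subset.trans hU), ?_⟩
        · have hm1 : m = 1 := by have := (Prod.mk.inj heq).2; omega
          subst hm1
          refine ⟨rfl, eq_empty_of_forall_notMem fun i hi => ?_⟩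
          have h1 := mem_range.1 (hU hi)
          have h3 : e + 2 * l = i := by omega
          exact h (h3 ▸ hi)
        · congr 1
          rw [insert_sdiff_of_notMem, insert_comm]
          simp only [mem_Ico]
          omega
  · have hUeq : U = range m :=
      subset_antisymm hU fun i hi => hall i ((mem_range.1 hi).trans_le (not_lt.1 hlt))
    rcases Nat.even_or_odd' m with ⟨q, rfl | rfl⟩
    · have e1 : ∅ ∪ (∅ ∪ (Ico 0 (0 + 2 * q) ∪ {0 + 2 * q + 1})) = insert (2 * q + 1) U := by
        rw [hUeq]; ext i; simp
      have h1 := P.mBr_of_even K (n := 0) (l := q) (S := ∅) (T := ∅) (by simp) (by simp) (by simp)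
      have h3 := mDeg_even (n := 0) (l := q) (S := ∅) (T := ∅) (by simp) (by simp) (by simp)
      rw [e1] at h1 h3
      simp only [zero_add] at h1 h3
      exact genBr_of_signEq (by omega) (.inl (by simp [indLie])) h3 h2 h1
    -- The value `q = 0` is the excluded monomial; its would-be preimage `x_0 v_1` has level 1 and a
    -- letter.
    · have hq : q ≠ 0 := by
        rintro rfl
        exact hne (by rw [hUeq]; decide)
      have e1 : ∅ ∪ ({0} ∪ (Ico 1 (1 + 2 * q) ∪ {1 + 2 * q + 1})) = insert (2 * q + 1 + 1) U := by
        rw [hUeq]; ext i; simp; omega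
      have h1 := P.mBr_of_even K (n := 1) (l := q) (S := ∅) (T := {0}) (by simp) (by simp) (by simp)
      have h3 := mDeg_even (n := 1) (l := q) (S := ∅) (T := {0}) (by simp) (by simp) (by simp)
      rw [e1, add_comm 1] at h1 h3
      refine genBr_of_signEq (by omega) (.inl ?_) h3 h2 h1
      simpa [indLie] using Nat.pos_of_ne_zero hq

end PivotSystem

theorem mDeg_square (m : ℕ) : mDeg ({m + 1}, m + 2) = 2 * mDeg (∅, m) := by
  simp [mDeg, dg_add_two]

theorem eq_of_mem_indSuper_of_lt {S : Finset ℕ} {k : ℕ} (h : (S, k) ∈ indSuper) (hk : k < 2) :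
    S = ∅ := by
  rcases h with h | ⟨-, m, T, -, h⟩
  · interval_cases k <;> simpa [indLie] using h
  · have := (Prod.mk.inj h).2
    omega

end Generation
-- The operators on the Grassmann algebra satisfy the relations
section Operators

theorem mul_anticomm_mul_mul {A : Type*} [Ring A] {a p q r : A} (hp : a * p = -(p * a))
    (hq : a * q = -(q * a)) (hr : a * r = -(r * a)) : a * (p * q * r) = -(p * q * r * a) := by
  rw [← mul_assoc, ← mul_assoc, hp, neg_mul, neg_mul, mul_assoc p, hq, mul_neg, neg_mul, ← mul_assoc,
    mul_assoc _ a, hr]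
  simp only [mul_neg, neg_neg, mul_assoc]

variable (K : Type*) [Field K]

/-- Left multiplication by the Grassmann variable `x_i`. -/
noncomputable def mulX (i : ℕ) : EndG K := LinearMap.mulLeft K (x K i)

theorem mulX_apply (i : ℕ) (f : Grassmann K) : mulX K i f = x K i * f := rfl

theorem mulX_mul_self (i : ℕ) : mulX K i * mulX K i = 0 := by
  refine LinearMap.ext fun f => ?_
  simp only [Module.End.mul_apply, mulX_apply, ← mul_assoc, x, ExteriorAlgebra.ι_sq_zero]
  simp

theorem mulX_mul_comm (i j : ℕ) : mulX K i * mulX K j = -(mulX K j * mulX K i) := by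
  refine LinearMap.ext fun f => ?_
  have h := CliffordAlgebra.ι_mul_ι_add_swap (Q := (0 : QuadraticForm K (ℕ →₀ K)))
    (Finsupp.single i 1) (Finsupp.single j 1)
  simp only [QuadraticMap.polar, zero_apply, sub_zero, map_zero] at h
  simp only [Module.End.mul_apply, mulX_apply, ← mul_assoc, LinearMap.neg_apply]
  rw [← neg_mul]
  congr 1
  exact eq_neg_of_add_eq_zero_left h

theorem d_mul_d (i j : ℕ) : d K i * d K j = -(d K j * d K i) := by
  refine LinearMap.ext fun f => ?_
  exact CliffordAlgebra.contractLeft_comm _ _ _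

theorem d_mul_self (i : ℕ) : d K i * d K i = 0 := by
  refine LinearMap.ext fun f => ?_
  exact CliffordAlgebra.contractLeft_contractLeft _ _

theorem d_x_mul (i j : ℕ) (f : Grassmann K) :
    d K i (x K j * f) = (if j = i then f else 0) - x K j * d K i f := by
  have := CliffordAlgebra.contractLeft_ι_mul (Q := (0 : QuadraticForm K (ℕ →₀ K)))
    (Finsupp.lapply i) (Finsupp.single j 1) f
  refine this.trans ?_
  congr 1
  simp only [Finsupp.lapply_apply, Finsupp.single_apply]
  split_ifs <;> simp

theorem d_mul_mulX_self (i : ℕ) : d K i * mulX K i = 1 - mulX K i * d K i := by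
  refine LinearMap.ext fun f => ?_
  simp [mulX_apply, d_x_mul]

theorem d_mul_mulX {i j : ℕ} (h : i ≠ j) : d K i * mulX K j = -(mulX K j * d K i) := by
  refine LinearMap.ext fun f => ?_
  simp [mulX_apply, d_x_mul, h.symm]

theorem d_one (i : ℕ) : d K i 1 = 0 := CliffordAlgebra.contractLeft_one _ _

theorem pivotTerm_zero (i : ℕ) : pivotTerm K i 0 = d K i := by
  refine LinearMap.ext fun f => ?_
  simp [pivotTerm]

theorem pivotTerm_succ (i l : ℕ) :
    pivotTerm K i (l + 1) = mulX K i * mulX K (i + 1) * pivotTerm K (i + 2) l := by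
  refine LinearMap.ext fun f => ?_
  have h : (List.range (2 * (l + 1))).map (fun j => x K (i + j)) =
      x K i :: x K (i + 1) :: (List.range (2 * l)).map fun j => x K (i + 2 + j) := by
    rw [show 2 * (l + 1) = 2 * l + 1 + 1 by ring, List.range_succ_eq_map, List.range_succ_eq_map]
    simp only [List.map_cons, List.map_map, add_zero]
    congr 2
    refine List.map_congr_left fun j _ => ?_
    simp only [Function.comp, Nat.succ_eq_add_one]
    congr 1
    ring
  simp only [pivotTerm, h, Module.End.mul_apply, LinearMap.mulLeft_apply, List.prod_cons, mulX_apply,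
    mul_assoc]
  congr 5
  ring_nf

theorem v_apply_eq_sum (i : ℕ) (f : Grassmann K) :
    ∃ N, ∀ M, N ≤ M → v K i f = ∑ l ∈ Finset.range M, pivotTerm K i l f := by
  obtain ⟨N, hN⟩ := exists_d_eq_zero K f
  refine ⟨N, fun M hM => ?_⟩
  refine finsum_eq_sum_of_support_subset _ fun l hl => ?_
  by_contra h
  simp only [Finset.coe_range, Set.mem_Iio, not_lt] at h
  apply hl
  simp [pivotTerm, hN (i + 2 * l) (by omega)]

theorem v_eq (i : ℕ) : v K i = d K i + mulX K i * mulX K (i + 1) * v K (i + 2) := by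
  refine LinearMap.ext fun f => ?_
  obtain ⟨N, hN⟩ := v_apply_eq_sum K i f
  obtain ⟨N', hN'⟩ := v_apply_eq_sum K (i + 2) f
  rw [hN (max N N' + 1) (by omega), Finset.sum_range_succ', pivotTerm_zero, add_comm]
  simp only [LinearMap.add_apply, Module.End.mul_apply, pivotTerm_succ]
  rw [hN' (max N N') (by omega), map_sum, map_sum]

theorem pivotTerm_anticomm {a : EndG K} {i : ℕ}
    (hx : ∀ j, i ≤ j → a * mulX K j = -(mulX K j * a)) (hd : ∀ j, i ≤ j → a * d K j = -(d K j * a))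
    (l : ℕ) {m : ℕ} (hm : i ≤ m) : a * pivotTerm K m l = -(pivotTerm K m l * a) := by
  induction l generalizing m with
  | zero => rw [pivotTerm_zero, hd m hm]
  | succ l ih =>
    rw [pivotTerm_succ]
    exact mul_anticomm_mul_mul (hx m hm) (hx (m + 1) (by omega)) (ih (by omega))

/-- On a given element of the algebra both series are finite, so they can be truncated at a common
length and compared term by term. -/
theorem v_anticomm {a : EndG K} {i : ℕ}
    (hx : ∀ j, i ≤ j → a * mulX K j = -(mulX K j * a)) (hd : ∀ j, i ≤ j → a * d K j = -(d K j * a))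
    {m : ℕ} (hm : i ≤ m) : a * v K m = -(v K m * a) := by
  refine LinearMap.ext fun f => ?_
  obtain ⟨N, hN⟩ := v_apply_eq_sum K m f
  obtain ⟨N', hN'⟩ := v_apply_eq_sum K m (a f)
  simp only [Module.End.mul_apply, LinearMap.neg_apply]
  rw [hN (max N N') (by omega), hN' (max N N') (by omega), map_sum, ← Finset.sum_neg_distrib]
  refine Finset.sum_congr rfl fun l _ => ?_
  exact LinearMap.congr_fun (pivotTerm_anticomm K hx hd l hm) f

theorem mulX_mul_v {i m : ℕ} (h : i < m) : mulX K i * v K m = -(v K m * mulX K i) :=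
  v_anticomm K (i := i + 1) (fun j _ => mulX_mul_comm K i j)
    (fun j hj => by rw [d_mul_mulX K (by omega), neg_neg]) h

theorem d_mul_v {i m : ℕ} (h : i < m) : d K i * v K m = -(v K m * d K i) :=
  v_anticomm K (i := i + 1) (fun j hj => d_mul_mulX K (by omega)) (fun j _ => d_mul_d K i j) h

theorem pivotSystem : PivotSystem (mulX K) (d K) (v K) where
  mx_mul_self := mulX_mul_self K
  mx_mul_comm := mulX_mul_comm K
  d_mul_self := d_mul_self K
  d_mul_mx_self := d_mul_mulX_self K
  d_mul_mx := d_mul_mulX K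
  v_eq := v_eq K
  mx_mul_v := mulX_mul_v K
  d_mul_v := d_mul_v K

theorem v_one (n : ℕ) : v K n 1 = 0 := by
  obtain ⟨N, hN⟩ := v_apply_eq_sum K n 1
  rw [hN N le_rfl]
  refine Finset.sum_eq_zero fun l _ => ?_
  rw [pivotTerm, Module.End.mul_apply, d_one, map_zero]

theorem v_apply_x_of_lt {n m : ℕ} (h : n < m) : v K m (x K n) = 0 := by
  have := LinearMap.congr_fun (mulX_mul_v K h) 1
  simp only [Module.End.mul_apply, LinearMap.neg_apply, v_one, map_zero, mulX_apply, mul_one] at this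
  rw [← neg_neg (v K m (x K n)), ← this, neg_zero]

theorem v_apply_x_self (n : ℕ) : v K n (x K n) = 1 := by
  rw [v_eq, LinearMap.add_apply, Module.End.mul_apply, v_apply_x_of_lt K (by omega), map_zero,
    add_zero]
  have := LinearMap.congr_fun (d_mul_mulX_self K n) 1
  simpa [mulX_apply, d_one] using this

end Operators

/-! ### Linear independence of the monomials -/

section Independence

variable (K : Type*) [Field K]

/-- The iterated superderivative `∂_{iₖ} ⋯ ∂_{i₁}` followed by the projection to constants. -/
noncomputable def coefL : List ℕ → Grassmann K →ₗ[K] K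
  | [] => (ExteriorAlgebra.algebraMapInv).toLinearMap
  | i :: L => coefL L ∘ₗ d K i

theorem coefL_cons (i : ℕ) (L : List ℕ) (f : Grassmann K) :
    coefL K (i :: L) f = coefL K L (d K i f) := rfl

theorem d_mX_of_notMem {i : ℕ} {S : Finset ℕ} (h : i ∉ S) : d K i (mX (mulX K) S 1) = 0 := by
  have := LinearMap.congr_fun ((pivotSystem K).d_mul_mX K h) 1
  simpa [d_one] using this

theorem d_mX_of_mem {i : ℕ} {S : Finset ℕ} (h : i ∈ S) :
    SignEq (d K i (mX (mulX K) S 1)) (mX (mulX K) (S.erase i) 1) := by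
  have h1 := (pivotSystem K).mx_mul_mX (Finset.notMem_erase i S)
  rw [Finset.insert_erase h] at h1
  have h2 := d_mX_of_notMem K (Finset.notMem_erase i S)
  have h3 : d K i (mulX K i (mX (mulX K) (S.erase i) 1)) = mX (mulX K) (S.erase i) 1 := by
    rw [mulX_apply, d_x_mul, h2]
    simp
  rcases h1 with h1 | h1
  · left
    have := LinearMap.congr_fun h1 1
    rw [Module.End.mul_apply] at this
    rw [← this, h3]
  · right
    have := LinearMap.congr_fun h1 1
    rw [Module.End.mul_apply] at this
    rw [← neg_eq_iff_eq_neg, ← map_neg, ← h3, this]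
    rfl

theorem coefL_mX_ne_zero {L : List ℕ} {S : Finset ℕ} (h : coefL K L (mX (mulX K) S 1) ≠ 0) :
    S = L.toFinset := by
  induction L generalizing S with
  | nil =>
    induction S using Finset.induction_on_min with
    | empty => rfl
    | insert a S ha ih =>
      exfalso
      apply h
      rw [mX_insert_min ha, Module.End.mul_apply, mulX_apply]
      simp [coefL, x, ExteriorAlgebra.algebraMapInv]
  | cons i L ih =>
    rw [coefL_cons] at h
    by_cases hi : i ∈ S
    · have h1 : S.erase i = L.toFinset := by
        apply ih
        rcases d_mX_of_mem K hi with h' | h' <;> rw [h'] at h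
        · exact h
        · rwa [map_neg, neg_ne_zero] at h
      rw [List.toFinset_cons, ← h1, Finset.insert_erase hi]
    · rw [d_mX_of_notMem K hi, map_zero] at h
      exact absurd rfl h

theorem coefL_sort (S : Finset ℕ) : coefL K S.sort (mX (mulX K) S 1) = 1 := by
  induction S using Finset.induction_on_min with
  | empty => simp [mX_empty, coefL]
  | insert a S ha ih =>
    have haS : a ∉ S := fun h => lt_irrefl _ (ha a h)
    rw [Finset.sort_insert (· ≤ ·) (fun b hb => (ha b hb).le) haS, coefL_cons, mX_insert_min ha,
      Module.End.mul_apply, mulX_apply, d_x_mul, d_mX_of_notMem K haS]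
    simpa using ih

theorem coefL_sort_of_ne {S T : Finset ℕ} (h : S ≠ T) :
    coefL K S.sort (mX (mulX K) T 1) = 0 := by
  by_contra h'
  exact h (by simpa using (coefL_mX_ne_zero K h').symm)

/-- The system is triangular: on the letter `x_n`, the pivot `v_n` takes the value 1 and later
pivots the value 0. By induction on `n` the earlier levels have zero coefficients, so evaluation at
`x_n` leaves a combination of the `x_S`, whose coefficients are read off by iterated derivatives. -/
theorem linearIndepOn_mXv :
    LinearIndepOn K (mXv (mulX K) (v K)) {i : Finset ℕ × ℕ | i.1 ⊆ Finset.range i.2} := by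
  rw [linearIndepOn_iff]
  intro c hc h0
  suffices h : ∀ n, ∀ S, c (S, n) = 0 from Finsupp.ext fun i => h i.2 i.1
  intro n
  induction n using Nat.strong_induction_on with
  | _ n ih =>
    intro S
    have h1 := congrArg (coefL K S.sort) (LinearMap.congr_fun h0 (x K n))
    rw [Finsupp.linearCombination_apply, Finsupp.sum, LinearMap.sum_apply, map_sum,
      LinearMap.zero_apply, map_zero, Finset.sum_eq_single (S, n)] at h1
    · simpa [mXv, v_apply_x_self, coefL_sort] using h1
    · rintro ⟨T, m⟩ hT hne
      simp only [LinearMap.smul_apply, map_smul, mXv, Module.End.mul_apply]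
      rcases lt_trichotomy m n with h | rfl | h
      · rw [ih m h, zero_smul]
      · rw [v_apply_x_self, coefL_sort_of_ne K (by rintro rfl; exact hne rfl), smul_zero]
      · rw [v_apply_x_of_lt K h, map_zero, map_zero, smul_zero]
    · intro h
      rw [Finsupp.notMem_support_iff.1 h, zero_smul, LinearMap.zero_apply, map_zero]

end Independence
-- Parity and the supercommutator
section Parity

variable {K : Type*} [Field K]

theorem IsHomog.mul {α β : ZMod 2} {a b : EndG K} (ha : IsHomog α a) (hb : IsHomog β b) :
    IsHomog (α + β) (a * b) := by
  intro γ f hf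
  rw [add_assoc]
  exact ha _ _ (hb _ _ hf)

theorem isHomog_one : IsHomog 0 (1 : EndG K) := by
  intro β f hf
  rwa [zero_add]

theorem IsHomog.smul {α : ZMod 2} {a : EndG K} (h : IsHomog α a) (c : K) : IsHomog α (c • a) :=
  fun β f hf => Submodule.smul_mem _ c (h β f hf)

theorem isHomog_mulX (i : ℕ) : IsHomog 1 (mulX K i) := fun β _ hf =>
  CliffordAlgebra.evenOdd_mul_le _ 1 β
    (Submodule.mul_mem_mul (CliffordAlgebra.ι_mem_evenOdd_one _ _) hf)

theorem isHomog_d (i : ℕ) : IsHomog 1 (d K i) := by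
  intro β f hf
  induction f, hf using CliffordAlgebra.evenOdd_induction with
  | range_ι_pow w hw =>
    obtain rfl | rfl : β = 0 ∨ β = 1 :=
      (by decide : ∀ β : ZMod 2, β = 0 ∨ β = 1) β
    · rw [ZMod.val_zero, pow_zero, Submodule.mem_one] at hw
      obtain ⟨r, rfl⟩ := hw
      rw [d, CliffordAlgebra.contractLeft_algebraMap]
      exact Submodule.zero_mem _
    · rw [ZMod.val_one, pow_one] at hw
      obtain ⟨m, rfl⟩ := hw
      rw [d, CliffordAlgebra.contractLeft_ι, show (1 : ZMod 2) + 1 = 0 by decide]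
      exact SetLike.algebraMap_mem_graded (parityPart K) _
  | add a b _ _ ha hb =>
    rw [map_add]
    exact Submodule.add_mem _ ha hb
  | ι_mul_ι_mul m₁ m₂ a ha ih =>
    have hι := fun (m : ℕ →₀ K) =>
      CliffordAlgebra.ι_mem_evenOdd_one (0 : QuadraticForm K (ℕ →₀ K)) m
    have h2 := fun (γ : ZMod 2) (g : Grassmann K) (m : ℕ →₀ K) (hg : g ∈ parityPart K γ) =>
      CliffordAlgebra.evenOdd_mul_le (0 : QuadraticForm K (ℕ →₀ K)) 1 γ
        (Submodule.mul_mem_mul (hι m) hg)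
    have e1 : (1 : ZMod 2) + (1 + (1 + β)) = 1 + β :=
      (by decide : ∀ β : ZMod 2, 1 + (1 + (1 + β)) = 1 + β) β
    rw [d] at ih ⊢
    rw [mul_assoc, CliffordAlgebra.contractLeft_ι_mul, CliffordAlgebra.contractLeft_ι_mul, mul_sub]
    refine Submodule.sub_mem _ (Submodule.smul_mem _ _ (h2 _ _ _ ha)) (Submodule.sub_mem _ ?_ ?_)
    · rw [mul_smul_comm]
      exact Submodule.smul_mem _ _ (h2 _ _ _ ha)
    · rw [← e1]
      exact h2 _ _ _ (h2 _ _ _ ih)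

theorem isHomog_pivotTerm (i l : ℕ) : IsHomog 1 (pivotTerm K i l) := by
  induction l generalizing i with
  | zero => rw [pivotTerm_zero]; exact isHomog_d i
  | succ l ih =>
    rw [pivotTerm_succ]
    have h := ((isHomog_mulX i).mul (isHomog_mulX (i + 1))).mul (ih (i + 2))
    rwa [show (1 : ZMod 2) + 1 + 1 = 1 by decide] at h

theorem isHomog_v (i : ℕ) : IsHomog 1 (v K i) := by
  intro β f hf
  obtain ⟨N, hN⟩ := v_apply_eq_sum K i f
  rw [hN N le_rfl]
  exact Submodule.sum_mem _ fun l _ => isHomog_pivotTerm i l β f hf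

theorem isHomog_mX (S : Finset ℕ) : IsHomog (S.card : ZMod 2) (mX (mulX K) S) := by
  induction S using Finset.induction_on_min with
  | empty => rw [mX_empty, Finset.card_empty, Nat.cast_zero]; exact isHomog_one
  | insert a S ha ih =>
    rw [mX_insert_min ha, Finset.card_insert_of_notMem fun h => lt_irrefl _ (ha a h), Nat.cast_succ,
      add_comm]
    exact (isHomog_mulX a).mul ih

theorem isHomog_mXv (i : Finset ℕ × ℕ) :
    IsHomog ((i.1.card + 1 : ℕ) : ZMod 2) (mXv (mulX K) (v K) i) := by
  rw [Nat.cast_succ]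
  exact (isHomog_mX i.1).mul (isHomog_v i.2)

theorem sum_proj (f : Grassmann K) : ∑ β : ZMod 2, GradedAlgebra.proj (parityPart K) β f = f := by
  classical
  conv_rhs => rw [← DirectSum.sum_support_decompose (parityPart K) f]
  symm
  refine Finset.sum_subset (Finset.subset_univ _) fun β _ h => ?_
  rw [DFinsupp.notMem_support_iff.1 h]
  rfl

theorem homogPart_apply (α : ZMod 2) (φ : EndG K) (f : Grassmann K) :
    homogPart α φ f = ∑ β : ZMod 2, GradedAlgebra.proj (parityPart K) (α + β)
      (φ (GradedAlgebra.proj (parityPart K) β f)) := by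
  simp [homogPart, LinearMap.sum_apply]

theorem proj_mem (β : ZMod 2) (f : Grassmann K) :
    GradedAlgebra.proj (parityPart K) β f ∈ parityPart K β := by
  rw [GradedAlgebra.proj_apply]
  exact SetLike.coe_mem _

theorem homogPart_same {α : ZMod 2} {φ : EndG K} (h : IsHomog α φ) : homogPart α φ = φ := by
  refine LinearMap.ext fun f => ?_
  rw [homogPart_apply]
  conv_rhs => rw [← sum_proj f, map_sum]
  refine Finset.sum_congr rfl fun β _ => ?_
  rw [GradedAlgebra.proj_apply (parityPart K) (α + β)]
  exact DirectSum.decompose_of_mem_same _ (h β _ (proj_mem β f))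

theorem homogPart_ne {α γ : ZMod 2} {φ : EndG K} (h : IsHomog α φ) (hγ : α ≠ γ) :
    homogPart γ φ = 0 := by
  refine LinearMap.ext fun f => ?_
  rw [homogPart_apply]
  refine Finset.sum_eq_zero fun β _ => ?_
  rw [GradedAlgebra.proj_apply (parityPart K) (γ + β)]
  exact DirectSum.decompose_of_mem_ne _ (h β _ (proj_mem β f)) fun e => hγ (add_right_cancel e)

theorem homogPart_add (α : ZMod 2) (φ ψ : EndG K) :
    homogPart α (φ + ψ) = homogPart α φ + homogPart α ψ := by
  refine LinearMap.ext fun f => ?_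
  simp only [homogPart_apply, LinearMap.add_apply, map_add, Finset.sum_add_distrib]

theorem homogPart_smul (α : ZMod 2) (c : K) (φ : EndG K) :
    homogPart α (c • φ) = c • homogPart α φ := by
  refine LinearMap.ext fun f => ?_
  simp only [homogPart_apply, LinearMap.smul_apply, map_smul, Finset.smul_sum]

theorem sum_homogPart (φ : EndG K) : ∑ α : ZMod 2, homogPart α φ = φ := by
  refine LinearMap.ext fun f => ?_
  rw [LinearMap.sum_apply]
  simp only [homogPart_apply]
  rw [Finset.sum_comm]
  conv_rhs => rw [← sum_proj f, map_sum]
  refine Finset.sum_congr rfl fun β _ => ?_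
  rw [← sum_proj (φ _)]
  exact Fintype.sum_equiv (Equiv.addRight β) _ _ fun α => by rw [sum_proj]; rfl

/-- The supercommutator as a bilinear map. -/
noncomputable def superBracketBilin (K : Type*) [Field K] : EndG K →ₗ[K] EndG K →ₗ[K] EndG K :=
  LinearMap.mk₂ K superBracket
    (fun a a' b => by
      simp only [superBracket, homogPart_add, add_mul, mul_add, smul_add, ← Finset.sum_add_distrib]
      refine Finset.sum_congr rfl fun α _ => Finset.sum_congr rfl fun β _ => ?_
      abel)
    (fun c a b => by
      simp only [superBracket, homogPart_smul, smul_mul_assoc, mul_smul_comm, Finset.smul_sum,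
        smul_sub, smul_comm _ c])
    (fun a b b' => by
      simp only [superBracket, homogPart_add, add_mul, mul_add, smul_add, ← Finset.sum_add_distrib]
      refine Finset.sum_congr rfl fun α _ => Finset.sum_congr rfl fun β _ => ?_
      abel)
    (fun c a b => by
      simp only [superBracket, homogPart_smul, smul_mul_assoc, mul_smul_comm, Finset.smul_sum,
        smul_sub, smul_comm _ c])

theorem superBracket_of_isHomog {α β : ZMod 2} {a b : EndG K} (ha : IsHomog α a)
    (hb : IsHomog β b) :
    superBracket a b = a * b - (-1 : K) ^ (α.val * β.val) • (b * a) := by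
  rw [superBracket, Finset.sum_eq_single α, Finset.sum_eq_single β, homogPart_same ha,
    homogPart_same hb]
  · intro γ _ hγ
    rw [homogPart_ne hb hγ.symm]
    simp
  · simp
  · intro γ _ hγ
    rw [homogPart_ne ha hγ.symm]
    simp
  · simp

/-- All signs become 1, so the parity components can be summed back together. This lets the super
and the ordinary types share one model. -/
theorem superBracket_char_two (h : (2 : K) = 0) (a b : EndG K) :
    superBracket a b = a * b - b * a := by
  have h1 : (-1 : K) = 1 := by
    rw [neg_eq_iff_add_eq_zero, one_add_one_eq_two, h]
  simp only [superBracket, h1, one_pow, one_smul, Finset.sum_sub_distrib]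
  rw [← Finset.sum_mul_sum, sum_homogPart, sum_homogPart, Finset.sum_comm, ← Finset.sum_mul_sum,
    sum_homogPart, sum_homogPart]

theorem neg_one_pow_val (m n : ℕ) :
    (-1 : K) ^ ((m : ZMod 2).val * (n : ZMod 2).val) = (-1) ^ (m * n) := by
  rw [ZMod.val_natCast, ZMod.val_natCast]
  rw [neg_one_pow_eq_pow_mod_two, neg_one_pow_eq_pow_mod_two (n := m * n), Nat.mul_mod m n]

theorem superBracket_mXv (i j : Finset ℕ × ℕ) :
    superBracket (mXv (mulX K) (v K) i) (mXv (mulX K) (v K) j) = mBr K (mulX K) (v K) i j := by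
  rw [superBracket_of_isHomog (isHomog_mXv i) (isHomog_mXv j), neg_one_pow_val]
  rfl

theorem commutator_mXv (h : (2 : K) = 0) (i j : Finset ℕ × ℕ) :
    mXv (mulX K) (v K) i * mXv (mulX K) (v K) j - mXv (mulX K) (v K) j * mXv (mulX K) (v K) i =
      mBr K (mulX K) (v K) i j := by
  rw [← superBracket_mXv, superBracket_char_two h]

end Parity
-- From a monomial basis to the grading and the lower central series
section Model

variable {K : Type*} [Field K]

/-- The operator `x_S v_n`. -/
noncomputable abbrev bas (K : Type*) [Field K] (i : Finset ℕ × ℕ) : EndG K :=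
  mXv (mulX K) (v K) i

/-- The span of the operators `x_S v_n` with index in `I` and with degree satisfying `p`. -/
noncomputable def basSpan (K : Type*) [Field K] (I : Set (Finset ℕ × ℕ)) (p : ℕ → Prop) :
    Submodule K (EndG K) :=
  Submodule.span K (bas K '' {i | i ∈ I ∧ p (mDeg i)})

/-- The operators `x_S v_n` with index in `I` form a basis of the algebra defined by `Φ`. -/
structure Model (Φ : Ops K) (I : Set (Finset ℕ × ℕ)) : Prop where
  subset : I ⊆ indSuper
  gen_mem {e : ℕ} (he : e < 2) : (∅, e) ∈ I
  bilin : ∃ B : EndG K →ₗ[K] EndG K →ₗ[K] EndG K, ∀ a b, Φ.br a b = B a b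
  br_bas (i j : Finset ℕ × ℕ) : Φ.br (bas K i) (bas K j) = mBr K (mulX K) (v K) i j
  closed : BrClosed K (mulX K) (v K) I
  sq_closed : ∀ a ∈ Φ.sq, (2 : K) = 0 ∧ (∀ a b, Φ.br a b = a * b - b * a) ∧
    ∀ m, ({m + 1}, m + 2) ∈ I
  sq_smul : ∀ a ∈ Φ.sq, ∀ c : K, c • a ∈ Φ.sq
  gen : ∀ i ∈ I, 2 ≤ i.2 → GenBr K (mulX K) (v K) I i ∨
    ∃ m, i = ({m + 1}, m + 2) ∧ (∅, m) ∈ I ∧ v K m ∈ Φ.sq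

theorem bas_empty (m : ℕ) : bas K (∅, m) = v K m := by
  simp [mXv, mX_empty]

theorem basSpan_mono {I : Set (Finset ℕ × ℕ)} {p q : ℕ → Prop} (h : ∀ n, p n → q n) :
    basSpan K I p ≤ basSpan K I q :=
  Submodule.span_mono (Set.image_mono fun _ hi => ⟨hi.1, h _ hi.2⟩)

theorem bas_mem {I : Set (Finset ℕ × ℕ)} {p : ℕ → Prop} {i : Finset ℕ × ℕ} (hi : i ∈ I)
    (hp : p (mDeg i)) : bas K i ∈ basSpan K I p :=
  Submodule.subset_span ⟨i, ⟨hi, hp⟩, rfl⟩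

theorem linearIndepOn_bas {I : Set (Finset ℕ × ℕ)} (h : I ⊆ indSuper) :
    LinearIndepOn K (bas K) I :=
  (linearIndepOn_mXv K).mono fun _ hi => subset_of_mem_indSuper (h hi)

theorem basSpan_disjoint {I : Set (Finset ℕ × ℕ)} (h : I ⊆ indSuper) {p q : ℕ → Prop}
    (hpq : ∀ n, p n → ¬ q n) : Disjoint (basSpan K I p) (basSpan K I q) := by
  have h1 : ∀ p : ℕ → Prop, bas K '' {i | i ∈ I ∧ p (mDeg i)} =
      (fun i : I => bas K i) '' {i | p (mDeg i)} := by
    intro p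
    ext a
    constructor
    · rintro ⟨i, ⟨hi, hp⟩, rfl⟩
      exact ⟨⟨i, hi⟩, hp, rfl⟩
    · rintro ⟨⟨i, hi⟩, hp, rfl⟩
      exact ⟨i, ⟨hi, hp⟩, rfl⟩
  rw [basSpan, basSpan, h1, h1]
  exact LinearIndependent.disjoint_span_image (linearIndepOn_bas h)
    (Set.disjoint_left.2 fun i hi => hpq _ hi)

theorem basSpan_sup {I : Set (Finset ℕ × ℕ)} (p q : ℕ → Prop) :
    basSpan K I p ⊔ basSpan K I q = basSpan K I fun n => p n ∨ q n := by
  rw [basSpan, basSpan, ← Submodule.span_union, ← Set.image_union, basSpan]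
  congr 2
  ext i
  simp only [Set.mem_union, Set.mem_ofPred_eq]
  tauto

theorem basSpan_iSup {I : Set (Finset ℕ × ℕ)} {ι : Sort*} (p : ι → ℕ → Prop) :
    ⨆ j, basSpan K I (p j) = basSpan K I fun n => ∃ j, p j n := by
  simp only [basSpan]
  rw [← Submodule.span_iUnion, ← Set.image_iUnion]
  congr 2
  ext i
  simp

theorem mem_degComp {Φ : Ops K} {n₁ n₂ : ℕ} {a : EndG K} (h : IsMonomial Φ n₁ n₂ a) :
    a ∈ degComp Φ (n₁ + n₂) :=
  (le_iSup_of_le n₁ (le_iSup_of_le n₂ (le_iSup_of_le rfl le_rfl)) :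
    multiComp Φ n₁ n₂ ≤ degComp Φ (n₁ + n₂)) (Submodule.subset_span h)

theorem degComp_le {Φ : Ops K} {n : ℕ} {N : Submodule K (EndG K)}
    (h : ∀ n₁ n₂ a, IsMonomial Φ n₁ n₂ a → n₁ + n₂ = n → a ∈ N) : degComp Φ n ≤ N :=
  iSup_le fun n₁ => iSup_le fun n₂ => iSup_le fun hn =>
    Submodule.span_le.2 fun a ha => h n₁ n₂ a ha hn

theorem isMonomial_generator (Φ : Ops K) {e : ℕ} (he : e < 2) :
    ∃ n₁ n₂, n₁ + n₂ = 1 ∧ IsMonomial Φ n₁ n₂ (v K e) := by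
  interval_cases e
  exacts [⟨1, 0, rfl, .v_zero⟩, ⟨0, 1, rfl, .v_one⟩]

theorem isMonomial_mem_R {Φ : Ops K} {n₁ n₂ : ℕ} {a : EndG K} (h : IsMonomial Φ n₁ n₂ a) :
    a ∈ R Φ := by
  rw [R, Submodule.mem_sInf]
  rintro S ⟨h0, h1, hbr, hsq⟩
  induction h with
  | v_zero => exact h0
  | v_one => exact h1
  | br _ _ ha hb => exact hbr _ ha _ hb
  | sq _ hs ha => exact hsq _ ha hs

namespace Model

variable {Φ : Ops K} {I : Set (Finset ℕ × ℕ)} (M : Model Φ I)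

include M

theorem br_mem {p q r : ℕ → Prop} (h : ∀ m n, p m → q n → r (m + n)) {a b : EndG K}
    (ha : a ∈ basSpan K I p) (hb : b ∈ basSpan K I q) : Φ.br a b ∈ basSpan K I r := by
  obtain ⟨B, hB⟩ := M.bilin
  rw [hB]
  refine LinearMap.BilinMap.apply_apply_mem_of_mem_span _ _ _ B ?_ a b ha hb
  rintro _ ⟨i, hi, rfl⟩ _ ⟨j, hj, rfl⟩
  rw [← hB, M.br_bas]
  rcases M.closed i hi.1 j hj.1 with h0 | ⟨k, hk, hdeg, c, hc⟩
  · rw [h0]; exact Submodule.zero_mem _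
  · rw [hc]
    exact Submodule.smul_mem _ _ (bas_mem hk (hdeg ▸ h _ _ hi.2 hj.2))

/-- In characteristic 2 squaring is additive up to a commutator, so it is enough to square basis
monomials. -/
theorem sq_mem {p r : ℕ → Prop} (h : ∀ m n, p m → p n → r (m + n)) (hs : Φ.sq.Nonempty)
    {a : EndG K} (ha : a ∈ basSpan K I p) : a * a ∈ basSpan K I r := by
  obtain ⟨s, hs⟩ := hs
  obtain ⟨h2, hbr, hsq⟩ := M.sq_closed s hs
  have hneg : ∀ y : EndG K, y = -y := fun y => by
    rw [eq_neg_iff_add_eq_zero, ← two_smul K, h2, zero_smul]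
  refine Submodule.span_induction (p := fun a _ => a * a ∈ basSpan K I r) ?_ ?_ ?_ ?_ ha
  · rintro _ ⟨⟨S, n⟩, hi, rfl⟩
    rw [(pivotSystem K).mXv_mul_self K (subset_of_mem_indSuper (M.subset hi.1))]
    split_ifs with hS
    · subst hS
      refine bas_mem (hsq n) ?_
      rw [mDeg_square, two_mul]
      exact h _ _ hi.2 hi.2
    · exact Submodule.zero_mem _
  · rw [mul_zero]; exact Submodule.zero_mem _
  · intro x y hx hy hxx hyy
    have h1 := M.br_mem h hx hy
    rw [hbr, sub_eq_add_neg, ← hneg] at h1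
    have h3 : (x + y) * (x + y) = x * x + y * y + (x * y + y * x) := by
      rw [add_mul, mul_add, mul_add]; abel
    rw [h3]
    exact Submodule.add_mem _ (Submodule.add_mem _ hxx hyy) h1
  · intro c x _ hx
    rw [smul_mul_smul_comm]
    exact Submodule.smul_mem _ _ hx

theorem monomial_mem {n₁ n₂ : ℕ} {a : EndG K} (h : IsMonomial Φ n₁ n₂ a) :
    a ∈ basSpan K I (· = n₁ + n₂) := by
  induction h with
  | v_zero =>
    have := bas_mem (K := K) (p := (· = 1 + 0)) (M.gen_mem two_pos) rfl
    rwa [bas_empty] at this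
  | v_one =>
    have := bas_mem (K := K) (p := (· = 0 + 1)) (M.gen_mem one_lt_two) rfl
    rwa [bas_empty] at this
  | br _ _ ha hb =>
    refine M.br_mem ?_ ha hb
    rintro m n rfl rfl
    omega
  | sq _ hs ha =>
    refine M.sq_mem ?_ ⟨_, hs⟩ ha
    rintro m n rfl rfl
    omega

/-- By induction on the degree: outside the generators, each basis element comes from one of smaller
degree by bracketing with a generator or by squaring a pivot. -/
theorem exists_monomial {i : Finset ℕ × ℕ} (hi : i ∈ I) :
    ∃ (c : K) (a : EndG K) (n₁ n₂ : ℕ), IsMonomial Φ n₁ n₂ a ∧ n₁ + n₂ = mDeg i ∧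
      bas K i = c • a := by
  induction hd : mDeg i using Nat.strong_induction_on generalizing i with
  | _ d ih =>
    obtain ⟨B, hB⟩ := M.bilin
    obtain ⟨S, k⟩ := i
    by_cases hk : k < 2
    · obtain rfl := eq_of_mem_indSuper_of_lt (M.subset hi) hk
      obtain ⟨n₁, n₂, hn, ha⟩ := isMonomial_generator Φ hk
      exact ⟨1, _, n₁, n₂, ha, by rw [hn, ← hd, mDeg_generator hk], by rw [bas_empty, one_smul]⟩
    · rcases M.gen _ hi (not_lt.1 hk) with ⟨e, he, j, hj, hdeg, c, hc⟩ | ⟨m, hm, hmI, hsq⟩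
      · obtain ⟨c', a, n₁, n₂, ha, hn, hja⟩ := ih (mDeg j) (by omega) hj rfl
        obtain ⟨m₁, m₂, hm, he'⟩ := isMonomial_generator Φ he
        refine ⟨c * c', _, _, _, .br he' ha, by omega, ?_⟩
        rw [← M.br_bas, bas_empty, hB, hja, map_smul, ← hB, smul_smul] at hc
        exact hc
      · rw [hm, mDeg_square] at hd
        have hpos := mDeg_pos (M.subset hmI)
        obtain ⟨c, a, n₁, n₂, ha, hn, hja⟩ := ih (mDeg (∅, m)) (by omega) hmI rfl
        have hsqr := (pivotSystem K).mXv_mul_self K (n := m) (Finset.empty_subset _)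
        rw [if_pos rfl] at hsqr
        rw [hm]
        change bas K _ * bas K _ = bas K _ at hsqr
        -- A zero scalar would make `v_m` zero, against independence. Otherwise the monomial is a
        -- nonzero multiple of `v_m` and may be squared, since squarable elements are stable under
        -- scalars.
        by_cases hc : c = 0
        · rw [hc, zero_smul] at hja
          refine ⟨0, _, _, _, .v_zero, ?_, by rw [← hsqr, hja, zero_mul, zero_smul]⟩
          exfalso
          exact ((linearIndepOn_bas M.subset).ne_zero hmI) hja
        · have hasq : a ∈ Φ.sq := by
            have := M.sq_smul _ hsq c⁻¹
            rwa [← bas_empty, hja, smul_smul, inv_mul_cancel₀ hc, one_smul] at this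
          refine ⟨c * c, _, _, _, .sq ha hasq, by omega, ?_⟩
          rw [← hsqr, hja, smul_mul_smul_comm]

theorem degComp_eq (n : ℕ) : degComp Φ n = basSpan K I (· = n) := by
  refine le_antisymm (degComp_le fun n₁ n₂ a ha hn => hn ▸ M.monomial_mem ha) ?_
  refine Submodule.span_le.2 ?_
  rintro _ ⟨i, ⟨hi, rfl⟩, rfl⟩
  obtain ⟨c, a, n₁, n₂, ha, hn, h⟩ := M.exists_monomial hi
  rw [h, ← hn]
  exact Submodule.smul_mem _ _ (mem_degComp ha)

theorem R_eq : R Φ = basSpan K I fun _ => True := by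
  refine le_antisymm (sInf_le ⟨?_, ?_, fun a ha b hb => ?_, fun a ha hs => ?_⟩) ?_
  · exact basSpan_mono (fun _ _ => trivial) (M.monomial_mem .v_zero)
  · exact basSpan_mono (fun _ _ => trivial) (M.monomial_mem .v_one)
  · exact M.br_mem (fun _ _ _ _ => trivial) ha hb
  · exact M.sq_mem (fun _ _ _ _ => trivial) ⟨_, hs⟩ ha
  · refine Submodule.span_le.2 ?_
    rintro _ ⟨i, ⟨hi, -⟩, rfl⟩
    obtain ⟨c, a, n₁, n₂, ha, -, h⟩ := M.exists_monomial hi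
    rw [h]
    exact Submodule.smul_mem _ _ (isMonomial_mem_R ha)

theorem basSpan_one_le {n : ℕ} (hn : n ≤ 1) :
    (basSpan K I fun _ => True) = basSpan K I (n ≤ ·) := by
  rw [basSpan, basSpan]
  congr 2
  ext i
  simp only [Set.mem_ofPred_eq, and_true, iff_self_and]
  intro hi
  have := mDeg_pos (M.subset hi)
  omega

/-- Degrees are positive and add up, which gives one inclusion. For the other, a basis element of
degree at least 2 is a bracket of a generator with degree one less, or the square of a pivot of half
the degree. -/
theorem lcs_eq (n : ℕ) : lcs Φ n = basSpan K I (n ≤ ·) := by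
  induction n using Nat.strong_induction_on with
  | _ n ih =>
    rcases n with _ | _ | n
    · rw [lcs, M.R_eq]; exact M.basSpan_one_le (by omega)
    · rw [lcs, M.R_eq]; exact M.basSpan_one_le (by omega)
    · rw [lcs, ih (n + 1) (by omega), ih ((n + 3) / 2) (by omega)]
      apply le_antisymm
      · refine sup_le (Submodule.span_le.2 ?_) (Submodule.span_le.2 ?_)
        · rintro _ ⟨a, ha, b, hb, rfl⟩
          rw [M.R_eq, M.basSpan_one_le le_rfl] at ha
          exact M.br_mem (fun _ _ _ _ => by omega) ha hb
        · rintro _ ⟨a, ha, hs, rfl⟩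
          exact M.sq_mem (fun _ _ _ _ => by omega) ⟨_, hs⟩ ha
      · refine Submodule.span_le.2 ?_
        rintro _ ⟨⟨S, k⟩, ⟨hi, hd⟩, rfl⟩
        have hk : 2 ≤ k := by
          by_contra hk
          obtain rfl := eq_of_mem_indSuper_of_lt (M.subset hi) (not_le.1 hk)
          have := mDeg_generator (not_le.1 hk)
          omega
        rcases M.gen _ hi hk with ⟨e, he, j, hj, hdeg, c, hc⟩ | ⟨m, hm, hmI, hsq⟩
        · change bas K _ = _ at hc
          rw [hc]
          refine Submodule.smul_mem _ _ (Submodule.mem_sup_left (Submodule.subset_span ?_))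
          refine ⟨bas K (∅, e), ?_, bas K j, bas_mem hj (by omega), (M.br_bas _ _).symm⟩
          rw [M.R_eq]
          exact bas_mem (M.gen_mem he) trivial
        · rw [hm]
          rw [hm, mDeg_square] at hd
          refine Submodule.mem_sup_right (Submodule.subset_span
            ⟨bas K (∅, m), bas_mem hmI (by omega), by rwa [bas_empty], ?_⟩)
          have hsqr := (pivotSystem K).mXv_mul_self K (n := m) (Finset.empty_subset _)
          rw [if_pos rfl] at hsqr
          exact hsqr.symm

theorem isDegreeGrading : IsDegreeGrading Φ := by
  have h := M.degComp_eq
  refine ⟨?_, ?_, ?_, ?_, ?_⟩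
  · rw [h, basSpan, Submodule.span_eq_bot]
    rintro _ ⟨i, ⟨hi, h0⟩, -⟩
    have := mDeg_pos (M.subset hi)
    omega
  · intro n
    simp only [h, basSpan_iSup]
    refine basSpan_disjoint M.subset ?_
    rintro m rfl ⟨k, hk, rfl⟩
    exact hk rfl
  · simp only [h, basSpan_iSup, M.R_eq]
    congr 1
    simp
  · intro m n a ha b hb
    rw [h] at *
    exact M.br_mem (by rintro _ _ rfl rfl; rfl) ha hb
  · intro n a ha hs
    rw [h] at *
    exact M.sq_mem (by rintro _ _ rfl rfl; omega) ⟨_, hs⟩ ha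

/-- `R^n` is the direct sum of `R_n` and `R^{n+1}`, so the second isomorphism theorem applies. -/
theorem lcsFactorDim_eq (n : ℕ) : lcsFactorDim Φ n = degDim Φ n := by
  have h1 : lcs Φ n = degComp Φ n ⊔ lcs Φ (n + 1) := by
    rw [M.lcs_eq, M.lcs_eq, M.degComp_eq, basSpan_sup]
    congr 1
    funext m
    exact propext ⟨fun h => by omega, fun h => by omega⟩
  have h2 : Disjoint (degComp Φ n) (lcs Φ (n + 1)) := by
    rw [M.lcs_eq, M.degComp_eq]
    exact basSpan_disjoint M.subset fun m hm => by omega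
  have e := LinearMap.quotientInfEquivSupQuotient (degComp Φ n) (lcs Φ (n + 1))
  rw [lcsFactorDim, quotDim, degDim, h1, Submodule.submoduleOf, ← e.finrank_eq]
  have h3 : Submodule.comap (degComp Φ n).subtype (degComp Φ n) ⊓
      Submodule.comap (degComp Φ n).subtype (lcs Φ (n + 1)) = ⊥ := by
    rw [← Submodule.comap_inf, h2.eq_bot, Submodule.comap_bot, Submodule.ker_subtype]
  exact ((Submodule.quotEquivOfEqBot _ h3)).finrank_eq

theorem rank_degComp {n : ℕ} {s : Finset (Finset ℕ × ℕ)}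
    (hs : ∀ i, i ∈ s ↔ i ∈ I ∧ mDeg i = n) : Module.rank K (degComp Φ n) = s.card := by
  have hs' : {i | i ∈ I ∧ mDeg i = n} = ↑s := Set.ext fun i => (hs i).symm
  have h := (linearIndepOn_bas (K := K) M.subset).mono
    (fun i (hi : i ∈ {i | i ∈ I ∧ mDeg i = n}) => hi.1)
  rw [hs'] at h
  rw [M.degComp_eq, basSpan, hs', rank_span_set (LinearIndepOn.id_image h)]
  have := Cardinal.mk_image_eq_of_injOn_lift _ _ h.injOn
  simpa using this

end Model
end Model
-- Counting monomials of a given degree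
section Counting

open Finset

/-- The number of subsets of `{0, …, m - 1}` of weight `s`. -/
def cnt (m : ℕ) (s : ℤ) : ℕ := #{S ∈ (range m).powerset | ∑ i ∈ S, (dg i : ℤ) = s}

/-- Subsets are split by whether they contain `m`. Integer weights let an impossible target be
negative and count zero. -/
theorem cnt_succ (m : ℕ) (s : ℤ) : cnt (m + 1) s = cnt m s + cnt m (s - dg m) := by
  have hm : ∀ S ∈ (range m).powerset, m ∉ S := fun S hS h =>
    lt_irrefl _ (mem_range.1 (mem_powerset.1 hS h))
  rw [cnt, range_add_one, powerset_insert, filter_union, card_union_of_disjoint]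
  · congr 1
    rw [filter_image, card_image_of_injOn, cnt]
    · congr 1
      refine filter_congr fun S hS => ?_
      rw [sum_insert (hm S hS)]
      constructor <;> intro h <;> linarith
    · intro S hS T hT h
      have hS' := hm S (mem_filter.1 hS).1
      have hT' := hm T (mem_filter.1 hT).1
      rw [← erase_insert hS', ← erase_insert hT']
      exact congrArg (fun U => U.erase m) h
  · refine disjoint_left.2 fun S hS hS' => ?_
    obtain ⟨T, -, rfl⟩ := mem_image.1 (mem_filter.1 hS').1
    exact hm _ (mem_filter.1 hS).1 (mem_insert_self _ _)

/-- The weight of `{0, …, m - 1}`. -/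
def sig (m : ℕ) : ℤ := ∑ i ∈ range m, (dg i : ℤ)

theorem sig_even (m : ℕ) : sig (2 * m) = dg (2 * m) - 1 := by
  have := (sum_range_dg m).1
  rw [sig, ← Nat.cast_sum]
  omega

theorem sig_odd (m : ℕ) : sig (2 * m + 1) = dg (2 * m + 1) := by
  rw [sig, ← Nat.cast_sum, (sum_range_dg m).2]

theorem sig_eq (m : ℕ) : sig m = dg m ∨ sig m = dg m - 1 := by
  rcases Nat.even_or_odd' m with ⟨l, rfl | rfl⟩
  exacts [.inr (sig_even l), .inl (sig_odd l)]

theorem cnt_eq_zero {m : ℕ} {s : ℤ} (h : s < 0 ∨ sig m < s) : cnt m s = 0 := by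
  rw [cnt, card_eq_zero, filter_eq_empty_iff]
  intro S hS hs
  have h1 : ∑ i ∈ S, (dg i : ℤ) ≤ sig m :=
    sum_le_sum_of_subset_of_nonneg (mem_powerset.1 hS) fun _ _ _ => Int.natCast_nonneg _
  have h2 : 0 ≤ ∑ i ∈ S, (dg i : ℤ) := sum_nonneg fun _ _ => Int.natCast_nonneg _
  omega

/-- The sums without and with `m` fill the intervals from 0 to `sig m` and from `dg m` to `dg m +
sig m`. As `sig m` is `dg m` or `dg m - 1`, these are adjacent or share one point, where both counts
are 1. -/
theorem cnt_bounds (m : ℕ) : (∀ s, 0 ≤ s → s ≤ sig m → 1 ≤ cnt m s ∧ cnt m s ≤ 2) ∧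
    cnt m 0 = 1 ∧ cnt m (sig m) = 1 := by
  induction m with
  | zero =>
    have h : cnt 0 0 = 1 := by decide
    have h0 : sig 0 = 0 := rfl
    refine ⟨fun s hs hs' => ?_, h, h⟩
    obtain rfl : s = 0 := by omega
    omega
  | succ m ih =>
    obtain ⟨hb, h0, h1⟩ := ih
    have hsig : sig (m + 1) = sig m + dg m := sum_range_succ _ _
    have hpos := dg_pos m
    have hs := sig_eq m
    refine ⟨fun s hs0 hs1 => ?_, ?_, ?_⟩
    · rw [cnt_succ]
      rcases lt_or_ge s (dg m) with hlt | hge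
      · rw [cnt_eq_zero (.inl (by omega : s - dg m < 0))]
        exact hb s hs0 (by omega)
      · have h2 := hb (s - dg m) (by omega) (by omega)
        rcases lt_or_ge (sig m) s with hlt | hle
        · rw [cnt_eq_zero (.inr hlt)]
          omega
        · obtain rfl : s = sig m := by omega
          rw [h1, show sig m - dg m = 0 by omega, h0]
          omega
    · rw [cnt_succ, h0, cnt_eq_zero (.inl (by omega))]
    · rw [cnt_succ, hsig, cnt_eq_zero (.inr (by omega)), add_sub_cancel_right, h1]

theorem dg_mono : Monotone dg := by
  refine monotone_nat_of_le_succ fun n => ?_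
  rcases n with _ | n
  · decide
  · rw [dg_add_two]; omega

theorem dg_lt {m n : ℕ} (hm : 1 ≤ m) (h : m < n) : dg m < dg n := by
  refine lt_of_lt_of_le ?_ (dg_mono (Nat.succ_le_of_lt h))
  obtain ⟨k, rfl⟩ := Nat.exists_eq_add_of_le' hm
  have : dg (k + 1).succ = _ := dg_add_two k
  have := dg_pos k
  omega

theorem le_dg (n : ℕ) : n ≤ dg n := by
  induction n with
  | zero => decide
  | succ n ih =>
    rcases n with _ | n
    · decide
    · have := dg_lt (m := n + 1) (n := n + 1 + 1) (by omega) (by omega)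
      omega

/-- The indices in `indLie` of degree `t`. -/
def lieFin (t : ℕ) : Finset (Finset ℕ × ℕ) :=
  (range (t + 3)).biUnion fun n =>
    {S ∈ (range (n - 1)).powerset | ∑ i ∈ S, (dg i : ℤ) = dg n - t}.image fun S => (S, n)

/-- The indices of the monomials `x_S x_{m+1} v_{m+2}`, `S ⊆ {0, …, m - 1}`, of degree `t`. -/
def superFin (t : ℕ) : Finset (Finset ℕ × ℕ) :=
  (range (t + 1)).biUnion fun m =>
    {S ∈ (range m).powerset | ∑ i ∈ S, (dg i : ℤ) = 2 * dg m - t}.image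
      fun S => (insert (m + 1) S, m + 2)

/-- The indices of the squares of pivot elements of degree `t`. -/
def squareFin (t : ℕ) : Finset (Finset ℕ × ℕ) :=
  {m ∈ range (t + 1) | 2 * dg m = t}.image fun m => ({m + 1}, m + 2)

theorem sum_cast_eq_iff {S : Finset ℕ} {n t : ℕ} (hS : S ⊆ range n) :
    ∑ i ∈ S, (dg i : ℤ) = dg n - t ↔ mDeg (S, n) = t := by
  have := mDeg_add hS
  rw [← Nat.cast_sum]
  omega

theorem mem_lieFin {t : ℕ} {i : Finset ℕ × ℕ} : i ∈ lieFin t ↔ i ∈ indLie ∧ mDeg i = t := by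
  obtain ⟨S, n⟩ := i
  simp only [lieFin, mem_biUnion, mem_image, mem_filter, mem_powerset, mem_range, Prod.mk.injEq]
  constructor
  · rintro ⟨n, hn, S, ⟨hS, h⟩, rfl, rfl⟩
    have hS' : (S, n) ∈ indLie := hS
    exact ⟨hS, (sum_cast_eq_iff (subset_of_mem_indSuper (.inl hS'))).1 h⟩
  · rintro ⟨hS, h⟩
    refine ⟨n, ?_, S, ⟨hS, (sum_cast_eq_iff (subset_of_mem_indSuper (.inl hS))).2 h⟩, rfl, rfl⟩
    rcases n with _ | _ | n
    · omega
    · omega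
    -- A monomial of level `n + 2` in this set has degree at least `2 * dg n ≥ n`, which bounds the
    -- levels to search.
    · have h1 := mDeg_add (subset_of_mem_indSuper (.inl hS))
      have h2 : ∑ j ∈ S, dg j ≤ dg (n + 1) := sum_dg_le hS
      have h3 : dg (n + 1 + 1) = _ := dg_add_two n
      have := le_dg n
      omega

theorem sum_insert_cast_eq_iff {S : Finset ℕ} {m t : ℕ} (hS : S ⊆ range m) :
    ∑ i ∈ S, (dg i : ℤ) = 2 * dg m - t ↔ mDeg (insert (m + 1) S, m + 2) = t := by
  have hm : m + 1 ∉ S := fun h => by have := mem_range.1 (hS h); omega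
  have h : insert (m + 1) S ⊆ range (m + 2) :=
    insert_subset (by simp) (hS.trans (range_subset_range.2 (by omega)))
  rw [← sum_cast_eq_iff h, sum_insert hm, dg_add_two]
  push_cast
  constructor <;> intro h <;> linarith

theorem mem_superFin {t : ℕ} {i : Finset ℕ × ℕ} :
    i ∈ superFin t ↔ (∃ m, ∃ S ⊆ range m, i = (insert (m + 1) S, m + 2)) ∧ mDeg i = t := by
  simp only [superFin, mem_biUnion, mem_image, mem_filter, mem_powerset, mem_range]
  constructor
  · rintro ⟨m, hm, S, ⟨hS, h⟩, rfl⟩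
    exact ⟨⟨m, S, hS, rfl⟩, (sum_insert_cast_eq_iff hS).1 h⟩
  · rintro ⟨⟨m, S, hS, rfl⟩, h⟩
    have h' := (sum_insert_cast_eq_iff hS).2 h
    refine ⟨m, ?_, S, ⟨hS, h'⟩, rfl⟩
    have h1 := sum_dg_le hS
    rw [← Nat.cast_sum] at h'
    have := le_dg m
    omega

theorem mem_squareFin {t : ℕ} {i : Finset ℕ × ℕ} :
    i ∈ squareFin t ↔ (∃ m, i = ({m + 1}, m + 2)) ∧ mDeg i = t := by
  simp only [squareFin, mem_image, mem_filter, mem_range]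
  have h : ∀ m, mDeg ({m + 1}, m + 2) = 2 * dg m := fun m => by rw [mDeg_square]; rfl
  constructor
  · rintro ⟨m, ⟨-, hm⟩, rfl⟩
    exact ⟨⟨m, rfl⟩, by rw [h, hm]⟩
  · rintro ⟨⟨m, rfl⟩, hm⟩
    rw [h] at hm
    have := le_dg m
    exact ⟨m, ⟨by omega, hm⟩, rfl⟩

theorem card_lieFin (t : ℕ) : #(lieFin t) = ∑ n ∈ range (t + 3), cnt (n - 1) (dg n - t) := by
  rw [lieFin, card_biUnion]
  · refine sum_congr rfl fun n _ => ?_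
    rw [card_image_of_injective _ fun S T h => (Prod.mk.inj h).1, cnt]
  · intro n _ m _ hnm
    refine disjoint_left.2 fun i hi hi' => hnm ?_
    obtain ⟨S, -, rfl⟩ := mem_image.1 hi
    obtain ⟨T, -, h⟩ := mem_image.1 hi'
    exact (Prod.mk.inj h).2.symm

theorem card_superFin (t : ℕ) : #(superFin t) = ∑ m ∈ range (t + 1), cnt m (2 * dg m - t) := by
  rw [superFin, card_biUnion]
  · refine sum_congr rfl fun m _ => ?_
    rw [card_image_of_injOn, cnt]
    intro S hS T hT h
    have hm : ∀ S ∈ (range m).powerset, m + 1 ∉ S := fun S hS h => by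
      have := mem_range.1 (mem_powerset.1 hS h)
      omega
    rw [← erase_insert (hm S (mem_filter.1 hS).1), ← erase_insert (hm T (mem_filter.1 hT).1)]
    exact congrArg (fun U => U.erase (m + 1)) (Prod.mk.inj h).1
  · intro n _ m _ hnm
    refine disjoint_left.2 fun i hi hi' => hnm ?_
    obtain ⟨S, -, rfl⟩ := mem_image.1 hi
    obtain ⟨T, -, h⟩ := mem_image.1 hi'
    have := (Prod.mk.inj h).2
    omega

theorem exists_dg_lt_le {t : ℕ} (ht : 2 ≤ t) : ∃ i, dg (i + 1) < t ∧ t ≤ dg (i + 2) := by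
  have hex : ∃ k, t ≤ dg k := ⟨t, le_dg t⟩
  have h1 := Nat.find_spec hex
  have h2 := fun m (hm : m < Nat.find hex) => Nat.find_min hex hm
  generalize Nat.find hex = k at h1 h2
  rcases k with _ | _ | k
  · simp only [dg] at h1; omega
  · simp only [dg] at h1; omega
  · exact ⟨k, not_le.1 (h2 (k + 1) (by omega)), h1⟩

/-- Pivots of lower level have degree below `t`; at higher levels the letters allowed cannot bring
the degree down to `t`. -/
theorem card_lieFin_eq {i t : ℕ} (h1 : dg (i + 1) < t) (h2 : t ≤ dg (i + 2)) :
    #(lieFin t) = cnt (i + 1) (dg (i + 2) - t) + cnt (i + 2) (dg (i + 3) - t) := by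
  have hi := le_dg (i + 1)
  have hp := sum_pair (f := fun n => cnt (n - 1) (dg n - t)) (show i + 2 ≠ i + 3 by omega)
  simp only [show i + 2 - 1 = i + 1 by omega, show i + 3 - 1 = i + 2 by omega] at hp
  rw [card_lieFin, ← hp]
  symm
  refine sum_subset ?_ fun n _ hn => ?_
  · intro n hn
    simp only [mem_insert, mem_singleton, mem_range] at *
    omega
  · simp only [mem_insert, mem_singleton, not_or] at hn
    refine cnt_eq_zero ?_
    rcases lt_or_ge n (i + 2) with h | h
    · have := dg_mono (show n ≤ i + 1 by omega)
      omega
    · obtain ⟨k, rfl⟩ := Nat.exists_eq_add_of_le' (show 2 ≤ n by omega)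
      have := dg_mono (show i + 2 ≤ k by omega)
      have h3 := dg_add_two k
      have h4 := sig_eq (k + 1)
      rw [show k + 2 - 1 = k + 1 by omega]
      omega

theorem card_superFin_eq {i t : ℕ} (h1 : dg (i + 1) < t) (h2 : t ≤ dg (i + 2)) :
    #(superFin t) = cnt i (2 * dg i - t) + cnt (i + 1) (2 * dg (i + 1) - t) +
      cnt (i + 2) (2 * dg (i + 2) - t) := by
  have hi := le_dg (i + 1)
  rw [card_superFin, add_assoc, ← sum_pair (f := fun m => cnt m (2 * dg m - t))
    (show i + 1 ≠ i + 2 by omega), ← sum_insert (f := fun m => cnt m (2 * dg m - t)) (by simp)]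
  symm
  refine sum_subset ?_ fun n _ hn => ?_
  · intro n hn
    simp only [mem_insert, mem_singleton, mem_range] at *
    omega
  · simp only [mem_insert, mem_singleton, not_or] at hn
    refine cnt_eq_zero ?_
    rcases lt_or_ge n i with h | h
    -- Hence `2 * dg n ≤ dg i + 1 ≤ dg (i + 1) < t`, and the target weight is negative.
    · have h3 : 2 * dg n ≤ dg (n + 1) + 1 := by
        rcases Nat.even_or_odd' n with ⟨q, rfl | rfl⟩
        · have := (dg_succ_even q).1
          omega
        · have : dg (2 * q + 1 + 1) = _ := (dg_succ_even q).2
          omega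
      have h4 := dg_mono (show n + 1 ≤ i by omega)
      have h5 := dg_lt (m := i) (n := i + 1) (by omega) (by omega)
      omega
    · have := dg_lt (m := i + 2) (n := n) (by omega) (by omega)
      have := sig_eq n
      omega

/-- The second level contributes only for even `i` and `t = dg (i + 2)`, and there both targets are
extreme, so each count is 1. -/
theorem card_lieFin_bounds {t : ℕ} (ht : 2 ≤ t) : 1 ≤ #(lieFin t) ∧ #(lieFin t) ≤ 2 := by
  obtain ⟨i, h1, h2⟩ := exists_dg_lt_le ht
  rw [card_lieFin_eq h1 h2]
  have hd : dg (i + 3) = dg (i + 2) + 2 * dg (i + 1) := dg_add_two (i + 1)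
  rcases Nat.even_or_odd' i with ⟨q, rfl | rfl⟩
  · have e1 := dg_succ_even q
    have s1 := sig_odd q
    have s2 := sig_even (q + 1)
    rw [mul_add, mul_one] at s2
    obtain ⟨b1, b2, -⟩ := cnt_bounds (2 * q + 1)
    rcases h2.eq_or_lt with rfl | h2
    · rw [sub_self, b2, show (dg (2 * q + 3) : ℤ) - dg (2 * q + 2) = sig (2 * q + 2) by omega,
        (cnt_bounds _).2.2]
      omega
    · have := b1 (dg (2 * q + 2) - t) (by omega) (by omega)
      rw [cnt_eq_zero (m := 2 * q + 2) (.inr (by omega))]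
      omega
  · have e1 := dg_succ_even q
    have e2 := dg_succ_even (q + 1)
    have s1 := sig_even (q + 1)
    have s2 := sig_odd (q + 1)
    simp only [mul_add, mul_one, add_assoc, Nat.reduceAdd] at *
    obtain ⟨b1, -, -⟩ := cnt_bounds (2 * q + 2)
    have := b1 (dg (2 * q + 3) - t) (by omega) (by omega)
    rw [cnt_eq_zero (m := 2 * q + 3) (.inr (by omega))]
    omega

theorem card_lieFin_add_superFin_bounds {t : ℕ} (ht : 2 ≤ t) :
    2 ≤ #(lieFin t) + #(superFin t) ∧ #(lieFin t) + #(superFin t) ≤ 4 := by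
  obtain ⟨i, h1, h2⟩ := exists_dg_lt_le ht
  rw [card_lieFin_eq h1 h2, card_superFin_eq h1 h2]
  have hd : dg (i + 3) = dg (i + 2) + 2 * dg (i + 1) := dg_add_two (i + 1)
  rcases Nat.even_or_odd' i with ⟨q, rfl | rfl⟩
  · have e1 := dg_succ_even q
    have s1 := sig_odd q
    have s2 := sig_even (q + 1)
    rw [mul_add, mul_one] at s2
    have hp := dg_pos (2 * q + 1)
    obtain ⟨b1, b2, b3⟩ := cnt_bounds (2 * q + 1)
    rw [cnt_eq_zero (m := 2 * q + 2) (s := 2 * _ - _) (.inr (by omega))]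
    rcases h2.eq_or_lt with rfl | h2
    · rw [sub_self, b2, show (dg (2 * q + 3) : ℤ) - dg (2 * q + 2) = sig (2 * q + 2) by omega,
        (cnt_bounds _).2.2, cnt_eq_zero (m := 2 * q) (.inl (by omega)),
        cnt_eq_zero (m := 2 * q + 1) (.inl (by omega))]
      omega
    · have c1 := b1 (dg (2 * q + 2) - t) (by omega) (by omega)
      have c2 := b1 (2 * dg (2 * q + 1) - t) (by omega) (by omega)
      rw [cnt_eq_zero (m := 2 * q + 2) (.inr (by omega))]
      -- Level `2q` contributes only in this degree, where the Lie count is at the full weight and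
      -- equals 1, so the total stays within 4.
      by_cases h3 : t = dg (2 * q + 1) + 1
      · rw [show (2 * dg (2 * q) - t : ℤ) = 0 by omega, (cnt_bounds _).2.1,
          show (dg (2 * q + 2) - t : ℤ) = sig (2 * q + 1) by omega, b3]
        omega
      · rw [cnt_eq_zero (m := 2 * q) (.inl (by omega))]
        omega
  · have e1 := dg_succ_even q
    have e2 := dg_succ_even (q + 1)
    have s1 := sig_even (q + 1)
    have s2 := sig_odd (q + 1)
    simp only [mul_add, mul_one, add_assoc, Nat.reduceAdd] at *
    obtain ⟨b1, b2, -⟩ := cnt_bounds (2 * q + 2)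
    have c1 := b1 (dg (2 * q + 3) - t) (by omega) (by omega)
    have c2 := b1 (2 * dg (2 * q + 2) - t) (by omega) (by omega)
    rw [cnt_eq_zero (m := 2 * q + 3) (.inr (by omega)),
      cnt_eq_zero (m := 2 * q + 1) (.inl (by omega))]
    rcases h2.eq_or_lt with rfl | h2
    · rw [sub_self, b2, show (2 * dg (2 * q + 3) - dg (2 * q + 3) : ℤ) = sig (2 * q + 3) by omega,
        (cnt_bounds _).2.2]
      omega
    · rw [cnt_eq_zero (m := 2 * q + 3) (.inr (by omega))]
      omega

/-- From index 1 on, `dg` is strictly increasing. The bound on `t` excludes degree 2, where both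
`v_0²` and `v_1²` lie. -/
theorem card_squareFin_le {t : ℕ} (ht : 3 ≤ t) : #(squareFin t) ≤ 1 := by
  refine card_image_le.trans (card_le_one.2 fun m hm n hn => ?_)
  have h1 := (mem_filter.1 hm).2
  have h2 := (mem_filter.1 hn).2
  have h3 : ∀ k, 2 * dg k = t → 1 ≤ k := fun k hk => by
    rcases k with _ | k
    · simp only [dg] at hk; omega
    · omega
  rcases lt_trichotomy m n with h | h | h
  · have := dg_lt (h3 m h1) h; omega
  · exact h
  · have := dg_lt (h3 n h2) h; omega

/-- The indices in `indChar2` of degree `t`. -/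
def char2Fin (t : ℕ) : Finset (Finset ℕ × ℕ) := lieFin t ∪ squareFin t

/-- The indices in `indSuper` of degree `t`. -/
def indSuperFin (t : ℕ) : Finset (Finset ℕ × ℕ) := (lieFin t ∪ superFin t).erase ({0, 2}, 3)

theorem mem_char2Fin {t : ℕ} {i : Finset ℕ × ℕ} :
    i ∈ char2Fin t ↔ i ∈ indChar2 ∧ mDeg i = t := by
  rw [char2Fin, mem_union, mem_lieFin, mem_squareFin, ← or_and_right]
  rfl

theorem mem_indSuperFin {t : ℕ} {i : Finset ℕ × ℕ} :
    i ∈ indSuperFin t ↔ i ∈ indSuper ∧ mDeg i = t := by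
  have h : ({0, 2}, 3) ∉ indLie := by
    intro h
    have : ({0, 2} : Finset ℕ) ⊆ range 2 := h
    revert this
    decide
  rw [indSuperFin, mem_erase, mem_union, mem_lieFin, mem_superFin, ← or_and_right, ← and_assoc]
  refine and_congr_left fun _ => ⟨?_, ?_⟩
  · rintro ⟨hne, hi | hi⟩
    exacts [.inl hi, .inr ⟨hne, hi⟩]
  · rintro (hi | ⟨hne, hi⟩)
    exacts [⟨fun e => h (e ▸ hi), .inl hi⟩, ⟨hne, .inr hi⟩]

/-- The excluded monomial has degree 1, so the erasure has no effect here. -/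
theorem card_indSuperFin {t : ℕ} (ht : 2 ≤ t) : #(indSuperFin t) = #(lieFin t) + #(superFin t) := by
  rw [indSuperFin, erase_eq_of_notMem, card_union_of_disjoint]
  · refine disjoint_left.2 fun i hi hi' => ?_
    obtain ⟨⟨m, S, -, rfl⟩, -⟩ := mem_superFin.1 hi'
    have h : insert (m + 1) S ⊆ range (m + 1) := (mem_lieFin.1 hi).1
    have := mem_range.1 (h (mem_insert_self _ _))
    omega
  · intro h
    have h1 : mDeg ({0, 2}, 3) = t := by
      rcases mem_union.1 h with h | h
      exacts [(mem_lieFin.1 h).2, (mem_superFin.1 h).2]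
    have h2 : mDeg ({0, 2}, 3) = 1 := by decide
    omega

theorem card_lieFin_mem {t : ℕ} (ht : 1 ≤ t) : #(lieFin t) ∈ ({1, 2} : Set ℕ) := by
  rcases ht.eq_or_lt with rfl | ht
  · right; decide
  · have := card_lieFin_bounds ht
    simp only [Set.mem_insert_iff, Set.mem_singleton_iff]
    omega

theorem card_char2Fin_mem {t : ℕ} (ht : 1 ≤ t) : #(char2Fin t) ∈ ({1, 2, 3} : Set ℕ) := by
  simp only [Set.mem_insert_iff, Set.mem_singleton_iff]
  obtain rfl | rfl | ht : t = 1 ∨ t = 2 ∨ 3 ≤ t := by omega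
  · decide
  · decide
  · have h1 := card_lieFin_bounds (t := t) (by omega)
    have h2 := card_squareFin_le ht
    have h3 := card_union_le (lieFin t) (squareFin t)
    have h4 := card_le_card (subset_union_left (s₁ := lieFin t) (s₂ := squareFin t))
    rw [char2Fin]
    omega

theorem card_indSuperFin_mem {t : ℕ} (ht : 1 ≤ t) : #(indSuperFin t) ∈ ({2, 3, 4} : Set ℕ) := by
  rcases ht.eq_or_lt with rfl | ht
  · left; decide
  · have := card_lieFin_add_superFin_bounds ht
    rw [card_indSuperFin ht]
    simp only [Set.mem_insert_iff, Set.mem_singleton_iff]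
    omega

theorem card_char2Fin_two : #(char2Fin 2) = 3 := by decide

theorem card_lieFin_one : #(lieFin 1) = 2 := by decide

theorem card_indSuperFin_five : #(indSuperFin 5) = 4 := by decide

end Counting
-- The models for the four types and the conclusion
section Final

variable {K : Type*} [Field K]

theorem two_eq_zero (h : ringChar K = 2) : (2 : K) = 0 := by
  have := (ringChar.spec K 2).2 (by rw [h])
  exact_mod_cast this

theorem two_ne_zero_of_ringChar_ne (h : ringChar K ≠ 2) : (2 : K) ≠ 0 := fun h2 => by
  have h3 : ringChar K ∣ 2 := (ringChar.spec K 2).1 (by exact_mod_cast h2)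
  rcases (Nat.dvd_prime Nat.prime_two).1 h3 with h3 | h3
  exacts [CharP.ringChar_ne_one h3, h h3]

theorem model_lieSuper (h : ringChar K ≠ 2) : Model (lieSuper K) indSuper where
  subset := subset_rfl
  gen_mem he := .inl (by interval_cases ‹ℕ› <;> simp [indLie])
  bilin := ⟨superBracketBilin K, fun _ _ => rfl⟩
  br_bas := superBracket_mXv
  closed := (pivotSystem K).brClosed_indSuper
  sq_closed _ ha := absurd ha.1 h
  sq_smul _ ha := absurd ha.1 h
  gen _ hi hk := .inl ((pivotSystem K).genBr_indSuper (two_ne_zero_of_ringChar_ne h) hi hk)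

theorem model_lie (h : ringChar K = 2) : Model (lie K) indLie where
  subset := Set.subset_union_left
  gen_mem he := by interval_cases ‹ℕ› <;> simp [indLie]
  bilin := ⟨superBracketBilin K, fun a b => (superBracket_char_two (two_eq_zero h) a b).symm⟩
  br_bas := commutator_mXv (two_eq_zero h)
  closed := (pivotSystem K).brClosed_indLie (two_eq_zero h)
  sq_closed _ ha := absurd ha (Set.notMem_empty _)
  sq_smul _ ha := absurd ha (Set.notMem_empty _)
  gen _ hi hk := .inl ((pivotSystem K).genBr_indLie hi hk)

/-- Squares of monomials other than pivots vanish, so being able to square the pivots, which are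
odd, already gives the same basis for all three types. -/
theorem model_char_two (h : ringChar K = 2) {Φ : Ops K} (hbr : ∀ a b, Φ.br a b = a * b - b * a)
    (hsmul : ∀ a ∈ Φ.sq, ∀ c : K, c • a ∈ Φ.sq) (hv : ∀ m, v K m ∈ Φ.sq) :
    Model Φ indChar2 where
  subset := indChar2_subset
  gen_mem he := .inl (by interval_cases ‹ℕ› <;> simp [indLie])
  bilin := ⟨superBracketBilin K, fun a b =>
    (hbr a b).trans (superBracket_char_two (two_eq_zero h) a b).symm⟩
  br_bas i j := by rw [hbr, commutator_mXv (two_eq_zero h)]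
  closed := (pivotSystem K).brClosed_indChar2 (two_eq_zero h)
  sq_closed _ _ := ⟨two_eq_zero h, hbr, fun m => .inr ⟨m, rfl⟩⟩
  sq_smul := hsmul
  gen i hi hk := by
    rcases hi with hi | ⟨m, rfl⟩
    · exact .inl (((pivotSystem K).genBr_indLie hi hk).mono Set.subset_union_left)
    · exact .inr ⟨m, rfl, .inl (Finset.empty_subset _), hv m⟩

theorem Model.conclusion {Φ : Ops K} {I : Set (Finset ℕ × ℕ)} (M : Model Φ I)
    {s : ℕ → Finset (Finset ℕ × ℕ)} (hs : ∀ t i, i ∈ s t ↔ i ∈ I ∧ mDeg i = t) {D : Set ℕ} {w : ℕ}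
    (hD : ∀ t, 1 ≤ t → (s t).card ∈ D) (hw : ∀ k ∈ D, k ≤ w) {t₀ : ℕ} (ht₀ : 1 ≤ t₀)
    (hw₀ : (s t₀).card = w) :
    IsDegreeGrading Φ ∧
      (∀ n : ℕ, 1 ≤ n → lcsFactorDim Φ n = degDim Φ n ∧ degDim Φ n ∈ D) ∧ HasWidth Φ w := by
  refine ⟨M.isDegreeGrading, fun n hn => ⟨M.lcsFactorDim_eq n, ?_⟩, fun n hn => ?_, fun k hk => ?_⟩
  · rw [degDim, Module.finrank, M.rank_degComp (hs n), Cardinal.toNat_natCast]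
    exact hD n hn
  · rw [M.rank_degComp (hs n)]
    exact_mod_cast hw _ (hD n hn)
  · have := hk t₀ ht₀
    rw [M.rank_degComp (hs t₀), hw₀] at this
    exact_mod_cast this

end Final
end PivotLie

theorem theorem9p1 (K : Type*) [Field K] :
    (ringChar K ≠ 2 →
      PivotLie.IsDegreeGrading (PivotLie.lieSuper K) ∧
      (∀ n : ℕ, 1 ≤ n →
        PivotLie.lcsFactorDim (PivotLie.lieSuper K) n = PivotLie.degDim (PivotLie.lieSuper K) n ∧
        PivotLie.degDim (PivotLie.lieSuper K) n ∈ ({2, 3, 4} : Set ℕ)) ∧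
      PivotLie.HasWidth (PivotLie.lieSuper K) 4) ∧
    (ringChar K = 2 →
      PivotLie.IsDegreeGrading (PivotLie.lie K) ∧
      (∀ n : ℕ, 1 ≤ n →
        PivotLie.lcsFactorDim (PivotLie.lie K) n = PivotLie.degDim (PivotLie.lie K) n ∧
        PivotLie.degDim (PivotLie.lie K) n ∈ ({1, 2} : Set ℕ)) ∧
      PivotLie.HasWidth (PivotLie.lie K) 2) ∧
    (ringChar K = 2 →
      ∀ Φ ∈ ({PivotLie.lieSuper K, PivotLie.restrictedLieSuper2 K,
          PivotLie.restrictedLie2 K} : Set (PivotLie.Ops K)),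
        PivotLie.IsDegreeGrading Φ ∧
        (∀ n : ℕ, 1 ≤ n →
          PivotLie.lcsFactorDim Φ n = PivotLie.degDim Φ n ∧
          PivotLie.degDim Φ n ∈ ({1, 2, 3} : Set ℕ)) ∧
        PivotLie.HasWidth Φ 3) := by
  refine ⟨fun h => ?_, fun h => ?_, fun h Φ hΦ => ?_⟩
  · refine (PivotLie.model_lieSuper h).conclusion (fun _ _ => PivotLie.mem_indSuperFin)
      (fun _ => PivotLie.card_indSuperFin_mem) ?_ (by decide) PivotLie.card_indSuperFin_five
    rintro k (rfl | rfl | rfl) <;> decide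
  · refine (PivotLie.model_lie h).conclusion (fun _ _ => PivotLie.mem_lieFin)
      (fun _ => PivotLie.card_lieFin_mem) ?_ le_rfl PivotLie.card_lieFin_one
    rintro k (rfl | rfl) <;> decide
  · have M : PivotLie.Model Φ PivotLie.indChar2 := by
      rcases hΦ with rfl | rfl | rfl
      · exact PivotLie.model_char_two h
          (PivotLie.superBracket_char_two (PivotLie.two_eq_zero h))
          (fun a ha c => ⟨h, ha.2.smul c⟩) fun m => ⟨h, PivotLie.isHomog_v m⟩
      · exact PivotLie.model_char_two h
          (PivotLie.superBracket_char_two (PivotLie.two_eq_zero h))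
          (fun a ha c => ha.imp (·.smul c) (·.smul c)) fun m => .inl (PivotLie.isHomog_v m)
      · exact PivotLie.model_char_two h (fun _ _ => rfl) (fun _ _ _ => Set.mem_univ _)
          fun _ => Set.mem_univ _
    refine M.conclusion (fun _ _ => PivotLie.mem_char2Fin)
      (fun _ => PivotLie.card_char2Fin_mem) ?_ (by decide) PivotLie.card_char2Fin_two
    rintro k (rfl | rfl | rfl) <;> decide
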